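/- Let $n\ge 3$ be an integer, $\gamma,\alpha,s\in\mathbb R$ and $q,r\in(0,\infty]$ with $$\gamma>-\min(2,n),\qquad \alpha>1,\qquad \alpha\ge\max\Bigl(1,1+\frac{\gamma}{n}\Bigr),\qquad \frac{\gamma}{\alpha-1}<s\le n,\qquad \alpha\le q\le\infty,\qquad \frac sn+\frac1q>0 ,$$ and put $q_c=\frac{n(\alpha-1)}{2+\gamma}$, $Q_c=\frac{n\alpha}{n+\gamma}$. Let $\dot K^s_{q,r}(\mathbb R^n)$ be the Herz space of all (real- or complex-valued) measurable functions $f$ with $\|f\|_{\dot K^s_{q,r}}=\bigl(\sum_{j\in\mathbb Z}[2^{js}\|f\chi_{A_j}\|_{L^q}]^r\bigr)^{1/r}<\infty$ (the supremum over $j$ if $r=\infty$), where $A_j=\{x\in\mathbb R^n:2^{j-1}\le|x|<2^j\}$, and let $\dot{\mathcal K}^s_{q,r}(\mathbb R^n)$ be the closure of $C_c^\infty(\mathbb R^n)$ in $\dot K^s_{q,r}(\mathbb R^n)$. Assume that either (i) $\frac sn+\frac1q=\frac1{q_c}<\frac1{Q_c}$, $q<\infty$ and $r=\infty$; or (ii)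 $\frac sn+\frac1q=\frac1{q_c}=\frac1{Q_c}$, and either $q<\infty$ and $r\le\alpha-1$, or $q\le\infty$ and $r\le\min(1,\alpha-1)$. Then for every $u_0\in\dot{\mathcal K}^s_{q,r}(\mathbb R^n)$ and every $T\in(0,\infty)$ there is at most one $u\in C([0,T];\dot{\mathcal K}^s_{q,r}(\mathbb R^n))$ which solves $\partial_tu-\Delta u=|x|^\gamma|u|^{\alpha-1}u$, $u(0)=u_0$, in the sense that $u(0)=u_0$ and, for every $t\in(0,T]$, $$u(t)=e^{t\Delta}u_0+\int_0^te^{(t-\tau)\Delta}\bigl[|\cdot|^\gamma|u(\tau)|^{\alpha-1}u(\tau)\bigr]\,d\tau\qquad\text{a.e. in }\mathbb R^n,$$ the integrals converging absolutely at almost every point, where $e^{t\Delta}f(x)=(4\pi t)^{-n/2}\int_{\mathbb R^n}e^{-|x-y|^2/(4t)}f(y)\,dy$. -/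

import Mathlib

open MeasureTheory Set Filter Topology
open scoped ENNReal

noncomputable section

namespace HardyHenon

/-- The scale-critical exponent `q_c = n (α - 1) / (2 + γ)`. -/
def qCrit (n : ℕ) (γ α : ℝ) : ℝ := n * (α - 1) / (2 + γ)

/-- The exponent `Q_c = n α / (n + γ)`. -/
def QCrit (n : ℕ) (γ α : ℝ) : ℝ := n * α / (n + γ)

/-- The dyadic annulus `A_j = {x ∈ ℝⁿ : 2 ^ (j - 1) ≤ |x| < 2 ^ j}`. -/
def annulus (n : ℕ) (j : ℤ) : Set (EuclideanSpace ℝ (Fin n)) :=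
  {x | (2 : ℝ) ^ (j - 1) ≤ ‖x‖ ∧ ‖x‖ < (2 : ℝ) ^ j}

/-- The quantity `2 ^ (j s) * ‖f χ_{A_j}‖_{L^q}`. -/
def herzPiece {n : ℕ} {𝕜 : Type*} [RCLike 𝕜] (s : ℝ) (q : ℝ≥0∞)
    (f : EuclideanSpace ℝ (Fin n) → 𝕜) (j : ℤ) : ℝ≥0∞ :=
  ENNReal.ofReal ((2 : ℝ) ^ ((j : ℝ) * s)) * eLpNorm ((annulus n j).indicator f) q volume

/-- The quasi-norm of the homogeneous Herz space, with values in `[0, ∞]`; here `0 < q, r ≤ ∞`. -/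
def herzNorm {n : ℕ} {𝕜 : Type*} [RCLike 𝕜] (s : ℝ) (q r : ℝ≥0∞)
    (f : EuclideanSpace ℝ (Fin n) → 𝕜) : ℝ≥0∞ :=
  if r = ⊤ then ⨆ j : ℤ, herzPiece s q f j
  else (∑' j : ℤ, herzPiece s q f j ^ r.toReal) ^ (1 / r.toReal)

/-- Membership in the homogeneous Herz space. Its elements are given by representatives,
which are identified when they agree almost everywhere. -/
def MemHerz {n : ℕ} {𝕜 : Type*} [RCLike 𝕜] (s : ℝ) (q r : ℝ≥0∞)
    (f : EuclideanSpace ℝ (Fin n) → 𝕜) : Prop :=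
  AEStronglyMeasurable f volume ∧ herzNorm s q r f < ⊤

/-- Membership in the closure of the smooth compactly supported functions in the Herz space. -/
def MemHerzClosure {n : ℕ} {𝕜 : Type*} [RCLike 𝕜] (s : ℝ) (q r : ℝ≥0∞)
    (f : EuclideanSpace ℝ (Fin n) → 𝕜) : Prop :=
  MemHerz s q r f ∧ ∀ ε : ℝ≥0∞, 0 < ε →
    ∃ g : EuclideanSpace ℝ (Fin n) → 𝕜,
      ContDiff ℝ ((⊤ : ℕ∞) : WithTop ℕ∞) g ∧ HasCompactSupport g ∧ herzNorm s q r (f - g) < ε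

/-- `u ∈ C([0, T]; X)`, where `X` is the closure of the smooth compactly supported functions in
the Herz space, with the topology of the quasi-norm. Only the values `u t`, `t ∈ [0, T]`, matter. -/
def MemCHerzClosure {n : ℕ} {𝕜 : Type*} [RCLike 𝕜] (s : ℝ) (q r : ℝ≥0∞) (T : ℝ)
    (u : ℝ → EuclideanSpace ℝ (Fin n) → 𝕜) : Prop :=
  (∀ t ∈ Icc 0 T, MemHerzClosure s q r (u t)) ∧
    ∀ t₀ ∈ Icc 0 T, Tendsto (fun t => herzNorm s q r (u t - u t₀)) (𝓝[Icc 0 T] t₀) (𝓝 0)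

/-- The Gauss kernel `(4 π t) ^ (-n / 2) * exp (-|x|² / (4 t))`, for `t > 0`. -/
def heatKernel {n : ℕ} (t : ℝ) (x : EuclideanSpace ℝ (Fin n)) : ℝ :=
  1 / Real.sqrt ((4 * Real.pi * t) ^ n) * Real.exp (-‖x‖ ^ 2 / (4 * t))

/-- The heat semigroup `(e^{tΔ} f)(x)`, for `t > 0`. -/
def heat {n : ℕ} {𝕜 : Type*} [RCLike 𝕜] (t : ℝ) (f : EuclideanSpace ℝ (Fin n) → 𝕜)
    (x : EuclideanSpace ℝ (Fin n)) : 𝕜 :=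
  ∫ y, heatKernel t (x - y) • f y

/-- The nonlinear term `|x| ^ γ |v| ^ (α - 1) v`. -/
def nonlin {n : ℕ} {𝕜 : Type*} [RCLike 𝕜] (γ α : ℝ) (v : EuclideanSpace ℝ (Fin n) → 𝕜)
    (x : EuclideanSpace ℝ (Fin n)) : 𝕜 :=
  (‖x‖ ^ γ * ‖v x‖ ^ (α - 1)) • v x

/-- `u` solves on `[0, T]` the integral equation
`u(t) = e^{tΔ} u₀ + ∫₀ᵗ e^{(t-τ)Δ} [|·|^γ |u(τ)|^{α-1} u(τ)] dτ`:
for every `t ∈ (0, T]` the equality holds at almost every `x`, all the integrals in it being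
absolutely convergent there; and `u(0) = u₀`. -/
structure IsMildSolution {n : ℕ} {𝕜 : Type*} [RCLike 𝕜] (γ α T : ℝ)
    (u₀ : EuclideanSpace ℝ (Fin n) → 𝕜) (u : ℝ → EuclideanSpace ℝ (Fin n) → 𝕜) : Prop where
  initial : u 0 =ᵐ[volume] u₀
  integrable_heat : ∀ t ∈ Ioc 0 T, ∀ᵐ x : EuclideanSpace ℝ (Fin n),
    Integrable (fun y => heatKernel t (x - y) • u₀ y) volume
  integrable_heat_nonlin : ∀ t ∈ Ioc 0 T, ∀ᵐ x : EuclideanSpace ℝ (Fin n),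
    ∀ᵐ τ : ℝ, τ ∈ Ioo 0 t →
      Integrable (fun y => heatKernel (t - τ) (x - y) • nonlin γ α (u τ) y) volume
  intervalIntegrable : ∀ t ∈ Ioc 0 T, ∀ᵐ x : EuclideanSpace ℝ (Fin n),
    IntervalIntegrable (fun τ => heat (t - τ) (nonlin γ α (u τ)) x) volume 0 t
  duhamel : ∀ t ∈ Ioc 0 T, ∀ᵐ x : EuclideanSpace ℝ (Fin n),
    u t x = heat t u₀ x + ∫ τ in (0 : ℝ)..t, heat (t - τ) (nonlin γ α (u τ)) x

end HardyHenon

end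

/-!
Two solutions are compared through `w = u - v`, measured by the Herz pieces
`herzPiece s q w k = 2 ^ (k s) ‖w χ_{A_k}‖_q`, always with a supremum over `k`. Put
`β = s + n / q`, which is `(2 + γ) / (α - 1)` at the critical scaling. Since `w` satisfies the
Duhamel formula with source `F = |x|^γ (|u|^(α-1) u - |v|^(α-1) v)`, the heat flow is cut into its
parts from the annulus `A_k` to the annulus `A_j`.

The point is that the problem is critical only globally. The hypothesis `γ / (α - 1) < s` says
exactly that `n / q < 2 / (α - 1)`, so that on a single annulus `e^{tΔ} : L^{q/α} → L^q` costs
`t ^ (-θ)` with `θ = n (α - 1) / (2 q) < 1`: this is integrable in time, and small over short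
times. Between distant annuli the Gauss kernel is bounded uniformly in time. Together
(`herzPiece_heat_le`) the part from `A_k` to `A_j` is bounded by
`annulusKernel n β θ j k t`, whose time integral is of order `2 ^ (-(j - k) (n - β - 2))` for
`k ≤ j` and `2 ^ (-(k - j) β)` for `k > j`. Here `β > 0`, and `β + 2 ≤ n` is the condition
`1 / q_c ≤ 1 / Q_c`. If it is strict, the time-integrated kernel maps bounded sequences to bounded
sequences (`kernelMajorant_iSup`); if it is an equality, the kernel is constant in `k ≤ j` and maps
summable sequences to bounded ones (`kernelMajorant_tsum`).

By Hölder's inequality (`herzPiece_nonlin_sub_le`) the pieces of `F` are at most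
`(herzPiece u k ^ (α - 1) + herzPiece v k ^ (α - 1)) * herzPiece w k`. The coefficient sequence is
bounded, respectively summable because `r ≤ α - 1`, and by continuity in time it is, near a given
time, small off a finite set of annuli (`HasSmallTails`): in the first case by approximation with
compactly supported smooth functions, in the second because the tails of a convergent series are
small. On the finitely many remaining annuli the time integral over a short interval is small
(`KernelMajorant.exists_small`). Hence, if `u = v` up to `t₀`, the supremum of `w` over a short
interval after `t₀` is at most half of itself (`IsMildSolution.herzPiece_sub_le`,
`IsMildSolution.exists_agree_after`), and `u = v` on the whole of `[0, T]` by a supremum argument.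

The time integral and the `L^q` norm in space are exchanged by Minkowski's inequality, which needs
joint measurability of the integrand. It holds because on each annulus the nonlinear term is a
continuous curve in `L^1` (`continuousOn_heat`).
-/

namespace HardyHenon

/-! ### Two general inequalities -/

/-- A consequence of Bernoulli's inequality for `(b / a) ^ (p + 1)`, valid for all `p > 0`. -/
theorem rpow_mul_sub_le {a b p : ℝ} (hb : 0 ≤ b) (hba : b ≤ a) (hp : 0 < p) :
    (a ^ p - b ^ p) * b ≤ p * a ^ p * (a - b) := by
  rcases hb.eq_or_lt with rfl | hb'
  · simp
    positivity
  have ha : 0 < a := hb'.trans_le hba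
  have h := one_add_mul_self_le_rpow_one_add (s := b / a - 1) (p := p + 1)
    (by have : 0 ≤ b / a := by positivity
        linarith) (by linarith)
  have e : (1 + (b / a - 1)) ^ (p + 1) = b ^ p * b / (a ^ p * a) := by
    rw [show 1 + (b / a - 1) = b / a by ring, Real.div_rpow hb ha.le, Real.rpow_add_one hb'.ne',
      Real.rpow_add_one ha.ne']
  rw [e, le_div_iff₀ (by positivity)] at h
  have e2 : (1 + (p + 1) * (b / a - 1)) * (a ^ p * a) = a ^ p * (a + (p + 1) * (b - a)) := by
    field_simp
  rw [e2] at h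
  nlinarith

/-- Local Lipschitz bound for the power nonlinearity `z ↦ |z| ^ p z`. -/
theorem norm_rpow_smul_sub_le {𝕜 : Type*} [RCLike 𝕜] {p : ℝ} (hp : 0 < p) (a b : 𝕜) :
    ‖(‖a‖ ^ p) • a - (‖b‖ ^ p) • b‖ ≤ (1 + p) * (‖a‖ ^ p + ‖b‖ ^ p) * ‖a - b‖ := by
  wlog h : ‖b‖ ≤ ‖a‖ generalizing a b
  · have := this b a (le_of_not_ge h)
    rw [norm_sub_rev, norm_sub_rev a b, add_comm (‖a‖ ^ p)]
    exact this
  have hap : 0 ≤ ‖a‖ ^ p := by positivity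
  have hm : ‖b‖ ^ p ≤ ‖a‖ ^ p := Real.rpow_le_rpow (norm_nonneg _) h hp.le
  have e : (‖a‖ ^ p) • a - (‖b‖ ^ p) • b = (‖a‖ ^ p) • (a - b) + (‖a‖ ^ p - ‖b‖ ^ p) • b := by
    rw [smul_sub, sub_smul]; abel
  rw [e]
  refine (norm_add_le _ _).trans ?_
  rw [norm_smul, norm_smul, Real.norm_of_nonneg hap, Real.norm_of_nonneg (sub_nonneg.2 hm)]
  have h1 := rpow_mul_sub_le (norm_nonneg b) h hp
  have h2 := norm_sub_norm_le a b
  have h3 : p * ‖a‖ ^ p * (‖a‖ - ‖b‖) ≤ p * ‖a‖ ^ p * ‖a - b‖ := by gcongr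
  have h4 : 0 ≤ (1 + p) * ‖b‖ ^ p * ‖a - b‖ := by positivity
  nlinarith

section Minkowski

variable {X Y : Type*} [MeasurableSpace X] [MeasurableSpace Y] {μ : Measure X} {ν : Measure Y}
  [SFinite μ]

/-- Minkowski's integral inequality when the bound `c` does not vanish, so that its powers can serve
as weights in Hölder's inequality. -/
theorem eLpNorm_lintegral_le_of_pos [SFinite ν] {q : ℝ≥0∞} (hq : 1 < q)
    {g : Y → X → ℝ≥0∞} (hg : Measurable (Function.uncurry g)) {c : Y → ℝ≥0∞} (hc : Measurable c)
    (hc0 : ∀ y, c y ≠ 0) (h : ∀ᵐ y ∂ν, eLpNorm (g y) q μ ≤ c y) :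
    eLpNorm (fun x => ∫⁻ y, g y x ∂ν) q μ ≤ ∫⁻ y, c y ∂ν := by
  by_cases htop : ∫⁻ y, c y ∂ν = ∞
  · simp [htop]
  have hcfin : ∀ᵐ y ∂ν, c y < ∞ := ae_lt_top hc htop
  rcases eq_or_ne q ∞ with rfl | hqt
  · have h1 : ∀ᵐ y ∂ν, ∀ᵐ x ∂μ, g y x ≤ c y := by
      filter_upwards [h] with y hy
      have := enorm_ae_le_eLpNormEssSup (g y) μ
      filter_upwards [this] with x hx
      rw [eLpNorm_exponent_top] at hy
      exact (by simpa using hx : g y x ≤ _).trans hy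
    have hm : MeasurableSet {z : Y × X | g z.1 z.2 ≤ c z.1} :=
      measurableSet_le hg (hc.comp measurable_fst)
    have h2 : ∀ᵐ x ∂μ, ∀ᵐ y ∂ν, g y x ≤ c y := (Measure.ae_ae_comm hm).1 h1
    rw [eLpNorm_exponent_top]
    refine eLpNormEssSup_le_of_ae_enorm_bound ?_
    filter_upwards [h2] with x hx
    simpa using lintegral_mono_ae hx
  · set Q := q.toReal with hQ
    have hQ1 : 1 < Q := by
      rw [hQ, ← ENNReal.toReal_one]
      exact (ENNReal.toReal_lt_toReal ENNReal.one_ne_top hqt).2 hq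
    have hQ0 : 0 < Q := by linarith
    have hq0 : q ≠ 0 := (zero_lt_one.trans hq).ne'
    have hconj : (Q.conjExponent).HolderConjugate Q := (Real.HolderConjugate.conjExponent hQ1).symm
    set Q' := Q.conjExponent with hQ'
    have hQ'0 : 0 < Q' := hconj.pos
    have hrel : Q / Q' = Q - 1 := by
      have := hconj.symm.sub_one_mul_conj
      field_simp
      linarith
    set J := ∫⁻ y, c y ∂ν with hJ
    -- weighted Hölder inequality in `y`
    have step : ∀ x, (∫⁻ y, g y x ∂ν) ^ Q ≤ J ^ (Q - 1) * ∫⁻ y, c y ^ (1 - Q) * g y x ^ Q ∂ν := by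
      intro x
      have hgx : Measurable fun y => g y x := hg.comp measurable_prodMk_right
      have h1 : ∫⁻ y, g y x ∂ν = ∫⁻ y, ((fun y => c y ^ (1 / Q')) *
          fun y => c y ^ (-(1 / Q')) * g y x) y ∂ν := by
        refine lintegral_congr_ae ?_
        filter_upwards [hcfin] with y hy
        simp only [Pi.mul_apply]
        rw [← mul_assoc, ← ENNReal.rpow_add _ _ (hc0 y) hy.ne, add_neg_cancel, ENNReal.rpow_zero,
          one_mul]
      rw [h1]
      refine (ENNReal.rpow_le_rpow (ENNReal.lintegral_mul_le_Lp_mul_Lq ν hconj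
        (hc.pow_const _).aemeasurable ((hc.pow_const _).mul hgx).aemeasurable) hQ0.le).trans ?_
      rw [ENNReal.mul_rpow_of_nonneg _ _ hQ0.le, ← ENNReal.rpow_mul, ← ENNReal.rpow_mul,
        one_div_mul_cancel hQ0.ne', ENNReal.rpow_one]
      have e1 : ∀ y, (c y ^ (1 / Q')) ^ Q' = c y := fun y => by
        rw [← ENNReal.rpow_mul, one_div_mul_cancel hQ'0.ne', ENNReal.rpow_one]
      have e2 : ∀ y, (c y ^ (-(1 / Q')) * g y x) ^ Q = c y ^ (1 - Q) * g y x ^ Q := fun y => by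
        rw [ENNReal.mul_rpow_of_nonneg _ _ hQ0.le, ← ENNReal.rpow_mul]
        congr 2
        rw [neg_mul, one_div_mul_eq_div, hrel]; ring
      simp_rw [Pi.mul_apply, e1, e2]
      rw [one_div_mul_eq_div, hrel]
    rw [eLpNorm_eq_lintegral_rpow_enorm_toReal hq0 hqt]
    simp only [enorm_eq_self, ← hQ]
    rw [one_div, ENNReal.rpow_inv_le_iff hQ0]
    calc ∫⁻ x, (∫⁻ y, g y x ∂ν) ^ Q ∂μ
        ≤ ∫⁻ x, J ^ (Q - 1) * ∫⁻ y, c y ^ (1 - Q) * g y x ^ Q ∂ν ∂μ := lintegral_mono step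
      _ = J ^ (Q - 1) * ∫⁻ x, ∫⁻ y, c y ^ (1 - Q) * g y x ^ Q ∂ν ∂μ := by
          rw [lintegral_const_mul']
          exact ENNReal.rpow_ne_top_of_nonneg (by linarith) htop
      _ = J ^ (Q - 1) * ∫⁻ y, ∫⁻ x, c y ^ (1 - Q) * g y x ^ Q ∂μ ∂ν := by
          rw [lintegral_lintegral_swap]
          have : Measurable fun z : X × Y => c z.2 ^ (1 - Q) * g z.2 z.1 ^ Q :=
            ((hc.comp measurable_snd).pow_const _).mul
              ((hg.comp measurable_swap).pow_const _)
          exact this.aemeasurable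
      _ ≤ J ^ (Q - 1) * ∫⁻ y, c y ∂ν := by
          gcongr 1
          refine lintegral_mono_ae ?_
          filter_upwards [h, hcfin] with y hy hyt
          have hgy : Measurable (g y) := hg.comp measurable_prodMk_left
          rw [lintegral_const_mul _ (hgy.pow_const _)]
          rw [eLpNorm_eq_lintegral_rpow_enorm_toReal hq0 hqt] at hy
          simp only [enorm_eq_self, ← hQ] at hy
          rw [one_div, ENNReal.rpow_inv_le_iff hQ0] at hy
          calc c y ^ (1 - Q) * ∫⁻ x, g y x ^ Q ∂μ ≤ c y ^ (1 - Q) * c y ^ Q := by gcongr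
            _ = c y := by
              rw [← ENNReal.rpow_add _ _ (hc0 y) hyt.ne, sub_add_cancel, ENNReal.rpow_one]
      _ = J ^ Q := by
          rw [← hJ]
          nth_rewrite 2 [← ENNReal.rpow_one J]
          rw [← ENNReal.rpow_add_of_nonneg _ _ (by linarith) zero_le_one, sub_add_cancel]

/-- Minkowski's integral inequality, for an integrand whose `L^q` norms are bounded by `c`. -/
theorem eLpNorm_lintegral_le [SigmaFinite ν] {q : ℝ≥0∞} (hq : 1 < q)
    {g : Y → X → ℝ≥0∞} (hg : Measurable (Function.uncurry g)) {c : Y → ℝ≥0∞} (hc : Measurable c)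
    (h : ∀ᵐ y ∂ν, eLpNorm (g y) q μ ≤ c y) :
    eLpNorm (fun x => ∫⁻ y, g y x ∂ν) q μ ≤ ∫⁻ y, c y ∂ν := by
  refine ENNReal.le_of_forall_pos_le_add fun ε hε _ => ?_
  -- make the bound positive by adding a positive function of small integral
  obtain ⟨k, hk0, hkm, hk⟩ := exists_pos_lintegral_lt_of_sigmaFinite ν
    (ENNReal.coe_pos.2 hε).ne'
  have := eLpNorm_lintegral_le_of_pos (μ := μ) (ν := ν) hq hg (c := fun y => c y + k y)
    (hc.add hkm.coe_nnreal_ennreal) (fun y => by simp [(hk0 y).ne'])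
    (h.mono fun y hy => hy.trans le_self_add)
  refine this.trans ?_
  rw [lintegral_add_left hc]
  gcongr

/-- Countable triangle inequality in `L^q`: Minkowski's inequality for the counting measure. -/
theorem eLpNorm_tsum_le {ι : Type*} [Countable ι] {q : ℝ≥0∞} (hq : 1 < q)
    {g : ι → X → ℝ≥0∞} (hg : ∀ i, Measurable (g i)) :
    eLpNorm (fun x => ∑' i, g i x) q μ ≤ ∑' i, eLpNorm (g i) q μ := by
  let _ : MeasurableSpace ι := ⊤
  have _ : MeasurableSingletonClass ι := ⟨fun _ => trivial⟩
  have := eLpNorm_lintegral_le (μ := μ) (ν := Measure.count) hq (g := g)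
    (measurable_from_prod_countable_right hg) (c := fun i => eLpNorm (g i) q μ)
    measurable_from_top (Eventually.of_forall fun _ => le_rfl)
  simpa [lintegral_count] using this

end Minkowski

/-! ### The Gauss kernel and the smoothing of the heat semigroup -/

variable {n : ℕ} {𝕜 : Type*} [RCLike 𝕜]

theorem heatKernel_nonneg (t : ℝ) (x : EuclideanSpace ℝ (Fin n)) : 0 ≤ heatKernel t x := by
  unfold heatKernel; positivity

theorem continuous_heatKernel (t : ℝ) :
    Continuous (heatKernel t : EuclideanSpace ℝ (Fin n) → ℝ) := by
  unfold heatKernel; fun_prop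

theorem heatKernel_eq {t : ℝ} (ht : 0 < t) (x : EuclideanSpace ℝ (Fin n)) :
    heatKernel t x =
      (4 * Real.pi * t) ^ (-(n : ℝ) / 2) * Real.exp (-(1 / (4 * t)) * ‖x‖ ^ 2) := by
  have h : (0 : ℝ) < 4 * Real.pi * t := by positivity
  unfold heatKernel
  congr 1
  · rw [Real.sqrt_eq_rpow, ← Real.rpow_natCast, ← Real.rpow_mul h.le, one_div, ← Real.rpow_neg h.le]
    congr 1; ring
  · congr 1; ring

theorem heatKernel_le {t : ℝ} (ht : 0 < t) (x : EuclideanSpace ℝ (Fin n)) :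
    heatKernel t x ≤ t ^ (-(n : ℝ) / 2) := by
  rw [heatKernel_eq ht]
  have h1 : (4 * Real.pi * t) ^ (-(n : ℝ) / 2) ≤ t ^ (-(n : ℝ) / 2) := by
    apply Real.rpow_le_rpow_of_nonpos ht
    · nlinarith [Real.pi_gt_three]
    · have : (0 : ℝ) ≤ n := n.cast_nonneg
      linarith
  have h2 : Real.exp (-(1 / (4 * t)) * ‖x‖ ^ 2) ≤ 1 := by
    apply Real.exp_le_one_iff.2
    have : 0 ≤ 1 / (4 * t) * ‖x‖ ^ 2 := by positivity
    linarith
  calc _ ≤ t ^ (-(n : ℝ) / 2) * 1 := by gcongr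
    _ = _ := mul_one _

theorem pow_mul_exp_neg_sq_le (n : ℕ) {y : ℝ} (hy : 0 ≤ y) :
    y ^ n * Real.exp (-y ^ 2) ≤ n.factorial * Real.exp 1 := by
  have h1 := Real.pow_div_factorial_le_exp y hy n
  rw [div_le_iff₀ (by positivity)] at h1
  calc y ^ n * Real.exp (-y ^ 2) ≤ (Real.exp y * n.factorial) * Real.exp (-y ^ 2) := by gcongr
    _ = n.factorial * Real.exp (y - y ^ 2) := by rw [sub_eq_add_neg, Real.exp_add]; ring
    _ ≤ n.factorial * Real.exp 1 := by gcongr; nlinarith [sq_nonneg (y - 1)]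

/-- Off the diagonal the Gauss kernel is bounded uniformly in time. -/
theorem heatKernel_le_norm {t : ℝ} (ht : 0 < t) {x : EuclideanSpace ℝ (Fin n)} {ρ : ℝ}
    (hρ : 0 < ρ) (hx : ρ ≤ ‖x‖) :
    heatKernel t x ≤ n.factorial * Real.exp 1 * ρ ^ (-(n : ℝ)) := by
  have h4 : (0 : ℝ) < 4 * t := by positivity
  set b := Real.sqrt (4 * t) with hb
  have hb0 : 0 < b := Real.sqrt_pos.2 h4
  have hb2 : b ^ 2 = 4 * t := Real.sq_sqrt h4.le
  have h1 : heatKernel t x ≤ (b ^ n)⁻¹ * Real.exp (-(‖x‖ / b) ^ 2) := by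
    unfold heatKernel
    have e : -‖x‖ ^ 2 / (4 * t) = -(‖x‖ / b) ^ 2 := by rw [div_pow, hb2]; ring
    rw [e, one_div]
    gcongr
    rw [← Real.sqrt_sq (pow_nonneg hb0.le n)]
    apply Real.sqrt_le_sqrt
    rw [← pow_mul, mul_comm, pow_mul, hb2]
    gcongr
    nlinarith [Real.pi_gt_three]
  have h2 := pow_mul_exp_neg_sq_le n (y := ‖x‖ / b) (by positivity)
  rw [Real.rpow_neg hρ.le, Real.rpow_natCast, ← div_eq_mul_inv, le_div_iff₀ (by positivity)]
  calc heatKernel t x * ρ ^ n ≤ ((b ^ n)⁻¹ * Real.exp (-(‖x‖ / b) ^ 2)) * ‖x‖ ^ n := by gcongr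
    _ = (‖x‖ / b) ^ n * Real.exp (-(‖x‖ / b) ^ 2) := by
        have : ‖x‖ = b * (‖x‖ / b) := by field_simp
        nth_rewrite 2 [this]
        rw [mul_pow]
        field_simp
    _ ≤ _ := h2

theorem lintegral_heatKernel {t : ℝ} (ht : 0 < t) :
    ∫⁻ y : EuclideanSpace ℝ (Fin n), ENNReal.ofReal (heatKernel t y) = 1 := by
  have hb : 0 < 1 / (4 * t) := by positivity
  have h0 := GaussianFourier.integral_rexp_neg_mul_sq_norm (V := EuclideanSpace ℝ (Fin n)) hb
  have e : Real.pi / (1 / (4 * t)) = 4 * Real.pi * t := by field_simp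
  rw [e, finrank_euclideanSpace_fin] at h0
  have hpos : (0 : ℝ) < 4 * Real.pi * t := by positivity
  have h1 : ∫ y : EuclideanSpace ℝ (Fin n), heatKernel t y = 1 := by
    simp_rw [heatKernel_eq ht]
    rw [integral_const_mul, h0, ← Real.rpow_add hpos]
    rw [show -(n : ℝ) / 2 + n / 2 = 0 by ring, Real.rpow_zero]
  have h2 : Integrable (heatKernel t : EuclideanSpace ℝ (Fin n) → ℝ) := by
    by_contra h
    rw [integral_undef h] at h1
    exact zero_ne_one h1
  rw [← ofReal_integral_eq_lintegral_ofReal h2 (Eventually.of_forall (heatKernel_nonneg t)), h1,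
    ENNReal.ofReal_one]

theorem lintegral_heatKernel_sub {t : ℝ} (ht : 0 < t) (x : EuclideanSpace ℝ (Fin n)) :
    ∫⁻ y : EuclideanSpace ℝ (Fin n), ENNReal.ofReal (heatKernel t (x - y)) = 1 := by
  rw [lintegral_sub_left_eq_self (fun z => ENNReal.ofReal (heatKernel t z)) x,
    lintegral_heatKernel ht]

theorem lintegral_heatKernel_sub' {t : ℝ} (ht : 0 < t) (y : EuclideanSpace ℝ (Fin n)) :
    ∫⁻ x : EuclideanSpace ℝ (Fin n), ENNReal.ofReal (heatKernel t (x - y)) = 1 := by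
  rw [lintegral_sub_right_eq_self (fun z => ENNReal.ofReal (heatKernel t z)) y,
    lintegral_heatKernel ht]

theorem enorm_heat_le (t : ℝ) (f : EuclideanSpace ℝ (Fin n) → 𝕜) (x : EuclideanSpace ℝ (Fin n)) :
    ‖heat t f x‖ₑ ≤ ∫⁻ y, ENNReal.ofReal (heatKernel t (x - y)) * ‖f y‖ₑ := by
  refine (enorm_integral_le_lintegral_enorm _).trans (lintegral_mono fun y => ?_)
  rw [enorm_smul, Real.enorm_of_nonneg (heatKernel_nonneg _ _)]

theorem heat_congr_ae {t : ℝ} {f g : EuclideanSpace ℝ (Fin n) → 𝕜} (h : f =ᵐ[volume] g) :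
    heat t f = heat t g := by
  funext x
  exact integral_congr_ae (h.mono fun y hy => by simp only [hy])

theorem measurable_heatKernel_sub (t : ℝ) : Measurable fun z : EuclideanSpace ℝ (Fin n) ×
    EuclideanSpace ℝ (Fin n) => ENNReal.ofReal (heatKernel t (z.1 - z.2)) :=
  ((continuous_heatKernel t).comp (continuous_fst.sub continuous_snd)).measurable.ennreal_ofReal

theorem measurable_heatKernel_sub_right (t : ℝ) (x : EuclideanSpace ℝ (Fin n)) :
    Measurable fun y : EuclideanSpace ℝ (Fin n) => ENNReal.ofReal (heatKernel t (x - y)) :=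
  ((continuous_heatKernel t).comp (continuous_const.sub continuous_id)).measurable.ennreal_ofReal

theorem measurable_heatKernel_sub_left (t : ℝ) (y : EuclideanSpace ℝ (Fin n)) :
    Measurable fun x : EuclideanSpace ℝ (Fin n) => ENNReal.ofReal (heatKernel t (x - y)) :=
  ((continuous_heatKernel t).comp (continuous_id.sub continuous_const)).measurable.ennreal_ofReal

/-- Jensen's inequality for the average against a probability density. -/
theorem lintegral_density_mul_rpow_le {X : Type*} [MeasurableSpace X] {μ : Measure X}
    {k f : X → ℝ≥0∞} (hk : Measurable k) (hk1 : ∫⁻ y, k y ∂μ = 1)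
    (hf : AEMeasurable f μ) {r : ℝ} (hr : 1 ≤ r) :
    (∫⁻ y, k y * f y ∂μ) ^ r ≤ ∫⁻ y, k y * f y ^ r ∂μ := by
  have hr0 : 0 < r := by linarith
  have hprob : IsProbabilityMeasure (μ.withDensity k) :=
    ⟨by rw [withDensity_apply _ MeasurableSet.univ, setLIntegral_univ, hk1]⟩
  have hac : μ.withDensity k ≪ μ := withDensity_absolutelyContinuous _ _
  have hfm : AEStronglyMeasurable f (μ.withDensity k) := (hf.mono_ac hac).aestronglyMeasurable
  have h := eLpNorm_le_eLpNorm_of_exponent_le (p := 1) (q := ENNReal.ofReal r)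
    (by rw [← ENNReal.ofReal_one]; exact ENNReal.ofReal_le_ofReal hr) hfm
  rw [eLpNorm_one_eq_lintegral_enorm, eLpNorm_eq_lintegral_rpow_enorm_toReal
    (by simpa using hr0) ENNReal.ofReal_ne_top, ENNReal.toReal_ofReal hr0.le, one_div,
    ENNReal.le_rpow_inv_iff hr0] at h
  simp only [enorm_eq_self] at h
  have e1 := lintegral_withDensity_eq_lintegral_mul₀ hk.aemeasurable hf
  have e2 := lintegral_withDensity_eq_lintegral_mul₀ hk.aemeasurable (hf.pow_const r)
  rw [e1, e2] at h
  exact h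

/-- Smoothing of the heat semigroup from `L^{q/α}` to `L^q`. With `r = q / α`, Jensen's inequality
gives `|e^{tΔ} f| ^ r ≤ h := e^{tΔ} |f| ^ r`, while `h` is at most `t ^ (-n / 2) ∫ |f| ^ r` and has
integral `∫ |f| ^ r`; it remains to integrate `h ^ α`. -/
theorem eLpNorm_heat_le {α : ℝ} (hα : 1 < α) {q : ℝ≥0∞} (hq : ENNReal.ofReal α ≤ q) {t : ℝ}
    (ht : 0 < t) {f : EuclideanSpace ℝ (Fin n) → 𝕜} (hf : AEStronglyMeasurable f volume) :
    eLpNorm (heat t f) q volume ≤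
      ENNReal.ofReal (t ^ (-((n : ℝ) / 2 * (α - 1) * (1 / q).toReal))) *
        eLpNorm f (q / ENNReal.ofReal α) volume := by
  have hα0 : 0 < α := by linarith
  rcases eq_or_ne q ∞ with rfl | hqt
  · rw [ENNReal.top_div_of_ne_top ENNReal.ofReal_ne_top]
    simp only [ENNReal.div_top, ENNReal.toReal_zero, mul_zero, neg_zero, Real.rpow_zero,
      ENNReal.ofReal_one, one_mul, eLpNorm_exponent_top]
    refine eLpNormEssSup_le_of_ae_enorm_bound (Eventually.of_forall fun x => ?_)
    refine (enorm_heat_le t f x).trans ?_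
    calc ∫⁻ y, ENNReal.ofReal (heatKernel t (x - y)) * ‖f y‖ₑ
        ≤ ∫⁻ y, ENNReal.ofReal (heatKernel t (x - y)) * eLpNormEssSup f volume := by
          refine lintegral_mono_ae ?_
          filter_upwards [enorm_ae_le_eLpNormEssSup f volume] with y hy
          gcongr
      _ = eLpNormEssSup f volume := by
          rw [lintegral_mul_const _ (measurable_heatKernel_sub_right t x),
            lintegral_heatKernel_sub ht, one_mul]
  set Q := q.toReal with hQ
  have hqQ : q = ENNReal.ofReal Q := (ENNReal.ofReal_toReal hqt).symm
  have hαQ : α ≤ Q := (ENNReal.ofReal_le_iff_le_toReal hqt).1 hq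
  have hQ0 : 0 < Q := by linarith
  have hq0 : q ≠ 0 := by rw [hqQ]; simpa using hQ0
  have hr : 1 ≤ Q / α := (one_le_div hα0).2 hαQ
  have hr0 : 0 < Q / α := by linarith
  have hq1 : q / ENNReal.ofReal α = ENNReal.ofReal (Q / α) := by
    rw [hqQ, ENNReal.ofReal_div_of_pos hα0]
  have hinv : (1 / q).toReal = 1 / Q := by rw [ENNReal.toReal_div]; simp [hQ]
  have hfe : AEMeasurable (fun y => ‖f y‖ₑ) volume := hf.enorm
  set J := ∫⁻ y, ‖f y‖ₑ ^ (Q / α) with hJ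
  set κ := ENNReal.ofReal (t ^ (-(n : ℝ) / 2)) with hκ
  set h : EuclideanSpace ℝ (Fin n) → ℝ≥0∞ := fun x =>
    ∫⁻ y, ENNReal.ofReal (heatKernel t (x - y)) * ‖f y‖ₑ ^ (Q / α) with hh
  have hsup : ∀ x, h x ≤ κ * J := fun x => by
    rw [hJ, ← lintegral_const_mul' _ _ ENNReal.ofReal_ne_top]
    refine lintegral_mono fun y => ?_
    gcongr
    exact heatKernel_le ht _
  have hint : ∫⁻ x, h x = J := by
    rw [hh, lintegral_lintegral_swap]
    · calc _ = ∫⁻ y, ‖f y‖ₑ ^ (Q / α) *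
            ∫⁻ x : EuclideanSpace ℝ (Fin n), ENNReal.ofReal (heatKernel t (x - y)) := by
            refine lintegral_congr fun y => ?_
            rw [lintegral_mul_const _ (measurable_heatKernel_sub_left t y), mul_comm]
        _ = J := by simp_rw [lintegral_heatKernel_sub' ht, mul_one, hJ]
    · exact (measurable_heatKernel_sub t).aemeasurable.mul (hfe.pow_const _).comp_snd
  have hpt : ∀ x, ‖heat t f x‖ₑ ^ Q ≤ (κ * J) ^ (α - 1) * h x := fun x => by
    have e : Q = Q / α * α := by field_simp
    calc ‖heat t f x‖ₑ ^ Q ≤ (h x) ^ α := by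
          rw [e, ENNReal.rpow_mul]
          gcongr
          exact (ENNReal.rpow_le_rpow (enorm_heat_le t f x) hr0.le).trans
            (lintegral_density_mul_rpow_le (measurable_heatKernel_sub_right t x)
              (lintegral_heatKernel_sub ht x) hfe hr)
      _ = (h x) ^ (α - 1) * h x := by
          nth_rewrite 3 [← ENNReal.rpow_one (h x)]
          rw [← ENNReal.rpow_add_of_nonneg _ _ (by linarith) zero_le_one, sub_add_cancel]
      _ ≤ _ := by
          have : 0 ≤ α - 1 := by linarith
          gcongr
          exact hsup x
  have hhm : AEMeasurable h volume := by
    have : AEMeasurable (fun z : EuclideanSpace ℝ (Fin n) × EuclideanSpace ℝ (Fin n) =>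
        ENNReal.ofReal (heatKernel t (z.1 - z.2)) * ‖f z.2‖ₑ ^ (Q / α)) (volume.prod volume) :=
      (measurable_heatKernel_sub t).aemeasurable.mul (hfe.pow_const _).comp_snd
    exact this.lintegral_prod_right'
  rw [eLpNorm_eq_lintegral_rpow_enorm_toReal hq0 hqt, ← hQ, one_div, ENNReal.rpow_inv_le_iff hQ0]
  rw [hq1, eLpNorm_eq_lintegral_rpow_enorm_toReal (by simpa using hr0) ENNReal.ofReal_ne_top,
    ENNReal.toReal_ofReal hr0.le, ← hJ, hinv]
  calc ∫⁻ x, ‖heat t f x‖ₑ ^ Q ≤ ∫⁻ x, (κ * J) ^ (α - 1) * h x := lintegral_mono hpt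
    _ = (κ * J) ^ (α - 1) * J := by rw [lintegral_const_mul'' _ hhm, hint]
    _ = κ ^ (α - 1) * J ^ α := by
        rw [ENNReal.mul_rpow_of_nonneg _ _ (by linarith), mul_assoc]
        congr 1
        nth_rewrite 2 [← ENNReal.rpow_one J]
        rw [← ENNReal.rpow_add_of_nonneg _ _ (by linarith) zero_le_one, sub_add_cancel]
    _ = _ := by
        rw [ENNReal.mul_rpow_of_nonneg _ _ hQ0.le, ← ENNReal.rpow_mul, hκ,
          ENNReal.ofReal_rpow_of_pos (by positivity), ENNReal.ofReal_rpow_of_pos (by positivity),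
          ← Real.rpow_mul ht.le, ← Real.rpow_mul ht.le]
        congr 3
        · field_simp
        · field_simp

/-! ### The heat flow between dyadic annuli -/

theorem measurableSet_annulus (n : ℕ) (j : ℤ) : MeasurableSet (annulus n j) :=
  (measurableSet_le measurable_const measurable_norm).inter
    (measurableSet_lt measurable_norm measurable_const)

theorem volume_annulus_le (n : ℕ) : ∃ c : ℝ, 0 < c ∧ ∀ k : ℤ,
    volume (annulus n k) ≤ ENNReal.ofReal (c * (2 : ℝ) ^ ((k : ℝ) * n)) := by
  set V := volume (Metric.ball (0 : EuclideanSpace ℝ (Fin n)) 1) with hV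
  have hVt : V ≠ ∞ := measure_ball_lt_top.ne
  obtain ⟨v, hv0, hv⟩ : ∃ v : ℝ, 0 ≤ v ∧ V = ENNReal.ofReal v :=
    ⟨V.toReal, ENNReal.toReal_nonneg, (ENNReal.ofReal_toReal hVt).symm⟩
  refine ⟨v + 1, by positivity, fun k => ?_⟩
  have h1 : annulus n k ⊆ Metric.ball 0 ((2 : ℝ) ^ k) := fun x hx => by
    simpa using hx.2
  refine (measure_mono h1).trans ?_
  rw [Measure.addHaar_ball_of_pos _ _ (by positivity), finrank_euclideanSpace_fin, ← hV, hv, ← ENNReal.ofReal_mul (by positivity)]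
  apply ENNReal.ofReal_le_ofReal
  have e : ((2 : ℝ) ^ k) ^ n = (2 : ℝ) ^ ((k : ℝ) * n) := by
    rw [Real.rpow_mul (by norm_num), Real.rpow_intCast, Real.rpow_natCast]
  rw [e, mul_comm]
  gcongr
  linarith

/-- Two points of non-adjacent annuli are separated by the larger scale. -/
theorem le_norm_sub_of_mem_annulus {j k : ℤ} (h : 2 ≤ |j - k|)
    {x y : EuclideanSpace ℝ (Fin n)} (hx : x ∈ annulus n j) (hy : y ∈ annulus n k) :
    (2 : ℝ) ^ (max j k - 2) ≤ ‖x - y‖ := by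
  wlog hjk : k ≤ j generalizing j k x y
  · rw [max_comm, norm_sub_rev]
    exact this (by rwa [abs_sub_comm]) hy hx (by omega)
  rw [max_eq_left hjk]
  rw [abs_of_nonneg (by omega)] at h
  have h1 : ‖y‖ ≤ (2 : ℝ) ^ (j - 2) := hy.2.le.trans (zpow_le_zpow_right₀ (by norm_num) (by omega))
  have h2 := norm_sub_norm_le x y
  have h3 : (2 : ℝ) ^ (j - 1) = 2 * 2 ^ (j - 2) := by
    rw [← zpow_one_add₀ (by norm_num)]; congr 1; ring
  have h4 := hx.1
  linarith

theorem toReal_one_div (q : ℝ≥0∞) : (1 / q).toReal = 1 / q.toReal := by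
  rw [ENNReal.toReal_div, ENNReal.toReal_one]

theorem toReal_one_div_div_ofReal {α : ℝ} (hα : 0 < α) (q : ℝ≥0∞) :
    (1 / (q / ENNReal.ofReal α)).toReal = α * (1 / q).toReal := by
  rw [toReal_one_div, toReal_one_div, ENNReal.toReal_div, ENNReal.toReal_ofReal hα.le]
  rw [one_div_div]; ring

theorem one_le_div_ofReal {α : ℝ} (hα : 0 < α) {q : ℝ≥0∞} (hq : ENNReal.ofReal α ≤ q) :
    1 ≤ q / ENNReal.ofReal α := by
  rw [ENNReal.le_div_iff_mul_le (Or.inl (by simpa using hα)) (Or.inl ENNReal.ofReal_ne_top)]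
  simpa using hq

theorem mul_toReal_one_div_le_one {α : ℝ} (hα : 0 < α) {q : ℝ≥0∞} (hq : ENNReal.ofReal α ≤ q) :
    α * (1 / q).toReal ≤ 1 := by
  rw [← toReal_one_div_div_ofReal hα]
  refine ENNReal.toReal_le_of_le_ofReal zero_le_one ?_
  rw [ENNReal.ofReal_one]
  simpa using one_le_div_ofReal hα hq

theorem eLpNorm_indicator_le_mul_volume {s : Set (EuclideanSpace ℝ (Fin n))} (hs : MeasurableSet s)
    {f : EuclideanSpace ℝ (Fin n) → 𝕜} (hf : AEStronglyMeasurable f volume) {q : ℝ≥0∞}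
    (hq : 1 ≤ q) :
    eLpNorm (s.indicator f) 1 volume ≤
      eLpNorm (s.indicator f) q volume * volume s ^ (1 - (1 / q).toReal) := by
  rw [eLpNorm_indicator_eq_eLpNorm_restrict hs, eLpNorm_indicator_eq_eLpNorm_restrict hs]
  have := eLpNorm_le_eLpNorm_mul_rpow_measure_univ hq (hf.restrict (s := s))
  rwa [ENNReal.toReal_one, Measure.restrict_apply_univ, one_div_one, ← toReal_one_div] at this

/-- The heat flow between two sets on which the Gauss kernel is at most `κ`. -/
theorem eLpNorm_indicator_heat_indicator_le {A B : Set (EuclideanSpace ℝ (Fin n))}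
    (hB : MeasurableSet B) {t κ : ℝ}
    (hκ : ∀ x ∈ A, ∀ y ∈ B, heatKernel t (x - y) ≤ κ)
    {f : EuclideanSpace ℝ (Fin n) → 𝕜} (hf : AEStronglyMeasurable f volume) {q q₁ : ℝ≥0∞}
    (hq₁ : 1 ≤ q₁) :
    eLpNorm (A.indicator (heat t (B.indicator f))) q volume ≤
      ENNReal.ofReal κ * volume A ^ (1 / q).toReal * volume B ^ (1 - (1 / q₁).toReal) *
        eLpNorm (B.indicator f) q₁ volume := by
  set c : ℝ≥0∞ := ENNReal.ofReal κ * eLpNorm (B.indicator f) 1 volume with hc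
  have h1 : ∀ x, ‖A.indicator (heat t (B.indicator f)) x‖ₑ ≤ ‖A.indicator (fun _ => c) x‖ₑ := by
    intro x
    by_cases hx : x ∈ A
    · rw [indicator_of_mem hx, indicator_of_mem hx, enorm_eq_self, hc,
        eLpNorm_one_eq_lintegral_enorm, ← lintegral_const_mul' _ _ ENNReal.ofReal_ne_top]
      refine (enorm_heat_le _ _ _).trans (lintegral_mono fun y => ?_)
      by_cases hy : y ∈ B
      · gcongr
        exact hκ x hx y hy
      · simp [indicator_of_notMem hy]
    · simp [indicator_of_notMem hx]
  refine (eLpNorm_mono_enorm h1).trans ((eLpNorm_indicator_const_le c q).trans ?_)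
  rw [enorm_eq_self, hc, ← toReal_one_div]
  calc _ ≤ ENNReal.ofReal κ * (eLpNorm (B.indicator f) q₁ volume *
        volume B ^ (1 - (1 / q₁).toReal)) * volume A ^ (1 / q).toReal := by
        gcongr
        exact eLpNorm_indicator_le_mul_volume hB hf hq₁
    _ = _ := by ring

/-- The time profile of the heat flow between annuli of unit size: an integrable singularity
`y ^ (-θ)` at `0` and the decay `y ^ (-n / 2)` at infinity. -/
noncomputable def timeProfile (n : ℕ) (θ y : ℝ) : ℝ :=
  if y ≤ 1 then y ^ (-θ) else y ^ (-(n : ℝ) / 2)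

/-- A bound, up to a constant, for the operator norm of the heat flow at time `t` from the annulus
of index `k` to that of index `j`, in the normalization of the Herz norms. With `l = max j k`, the
power of `2` is the product of the Herz weights, of the volume factors from Hölder's inequality, and
of the size `2 ^ (-l n)` of the Gauss kernel at distance `2 ^ l`; time is measured in units of
`4 ^ l`. -/
noncomputable def annulusKernel (n : ℕ) (β θ : ℝ) (j k : ℤ) (t : ℝ) : ℝ :=
  (2 : ℝ) ^ ((j : ℝ) * β + (k : ℝ) * (n - β - 2) - ((max j k : ℤ) : ℝ) * n) *
    timeProfile n θ (t * (2 : ℝ) ^ (-(2 * ((max j k : ℤ) : ℝ))))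

theorem timeProfile_nonneg (n : ℕ) (θ : ℝ) {y : ℝ} (hy : 0 ≤ y) : 0 ≤ timeProfile n θ y := by
  unfold timeProfile; split_ifs <;> positivity

theorem one_eq_ofReal_two_rpow_mul (a : ℝ) :
    (1 : ℝ≥0∞) = ENNReal.ofReal ((2 : ℝ) ^ (-a)) * ENNReal.ofReal ((2 : ℝ) ^ a) := by
  rw [← ENNReal.ofReal_mul (by positivity), ← Real.rpow_add (by norm_num), neg_add_cancel,
    Real.rpow_zero, ENNReal.ofReal_one]

/-- The annulus-to-annulus estimate from the smoothing of the heat semigroup. -/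
theorem herzPiece_heat_le_smoothing {α : ℝ} (hα : 1 < α) {q : ℝ≥0∞}
    (hq : ENNReal.ofReal α ≤ q) (s s' : ℝ) {t : ℝ} (ht : 0 < t) (j k : ℤ)
    {f : EuclideanSpace ℝ (Fin n) → 𝕜} (hf : AEStronglyMeasurable f volume) :
    herzPiece s q (heat t ((annulus n k).indicator f)) j ≤
      ENNReal.ofReal ((2 : ℝ) ^ ((j : ℝ) * s) * t ^ (-((n : ℝ) / 2 * (α - 1) * (1 / q).toReal)) *
        (2 : ℝ) ^ (-((k : ℝ) * s'))) * herzPiece s' (q / ENNReal.ofReal α) f k := by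
  unfold herzPiece
  have hf' : AEStronglyMeasurable ((annulus n k).indicator f) volume :=
    hf.indicator (measurableSet_annulus n k)
  have h := (eLpNorm_indicator_le (s := annulus n j) (heat t ((annulus n k).indicator f))).trans
    (eLpNorm_heat_le hα hq ht hf')
  have hone := one_eq_ofReal_two_rpow_mul ((k : ℝ) * s')
  refine (mul_le_mul_right h _).trans (le_of_eq ?_)
  rw [ENNReal.ofReal_mul (by positivity), ENNReal.ofReal_mul (by positivity)]
  set N := eLpNorm ((annulus n k).indicator f) (q / ENNReal.ofReal α) volume
  generalize ENNReal.ofReal (t ^ (-((n : ℝ) / 2 * (α - 1) * (1 / q).toReal))) = b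
  calc _ = ENNReal.ofReal ((2 : ℝ) ^ ((j : ℝ) * s)) * b * (1 * N) := by ring
    _ = _ := by rw [hone]; ring

/-- The annulus-to-annulus estimate from a pointwise bound `κ` of the Gauss kernel. -/
theorem herzPiece_heat_le_of_kernel_le {α : ℝ} (hα : 1 < α) {q : ℝ≥0∞}
    (hq : ENNReal.ofReal α ≤ q) (s s' : ℝ) :
    ∃ C : ℝ, 0 < C ∧ ∀ (j k : ℤ) (t κ : ℝ), 0 ≤ κ →
      (∀ x ∈ annulus n j, ∀ y ∈ annulus n k, heatKernel t (x - y) ≤ κ) →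
      ∀ f : EuclideanSpace ℝ (Fin n) → 𝕜, AEStronglyMeasurable f volume →
      herzPiece s q (heat t ((annulus n k).indicator f)) j ≤
        ENNReal.ofReal (C * κ * (2 : ℝ) ^ ((j : ℝ) * (s + n * (1 / q).toReal) +
          (k : ℝ) * (n - (s' + n * (α * (1 / q).toReal))))) *
        herzPiece s' (q / ENNReal.ofReal α) f k := by
  obtain ⟨c, hc, hvol⟩ := volume_annulus_le n
  have hα0 : 0 < α := by linarith
  set Qi := (1 / q).toReal with hQi
  have hQi0 : 0 ≤ Qi := ENNReal.toReal_nonneg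
  have hQi1 : 0 ≤ 1 - α * Qi := sub_nonneg.2 (mul_toReal_one_div_le_one hα0 hq)
  refine ⟨c ^ Qi * c ^ (1 - α * Qi), by positivity, fun j k t κ hκ hk f hf => ?_⟩
  have h := eLpNorm_indicator_heat_indicator_le (q := q)
    (measurableSet_annulus n k) hk hf (one_le_div_ofReal hα0 hq)
  rw [toReal_one_div_div_ofReal hα0, ← hQi] at h
  have hv : ∀ (i : ℤ) (a : ℝ), 0 ≤ a → volume (annulus n i) ^ a ≤
      ENNReal.ofReal (c ^ a * (2 : ℝ) ^ ((i : ℝ) * n * a)) := fun i a ha => by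
    refine (ENNReal.rpow_le_rpow (hvol i) ha).trans ?_
    rw [ENNReal.ofReal_rpow_of_nonneg (by positivity) ha, Real.mul_rpow hc.le (by positivity),
      ← Real.rpow_mul (by norm_num)]
  have hone := one_eq_ofReal_two_rpow_mul ((k : ℝ) * s')
  unfold herzPiece
  set N := eLpNorm ((annulus n k).indicator f) (q / ENNReal.ofReal α) volume with hN
  calc _ ≤ ENNReal.ofReal ((2 : ℝ) ^ ((j : ℝ) * s)) * (ENNReal.ofReal κ *
        ENNReal.ofReal (c ^ Qi * (2 : ℝ) ^ ((j : ℝ) * n * Qi)) *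
        ENNReal.ofReal (c ^ (1 - α * Qi) * (2 : ℝ) ^ ((k : ℝ) * n * (1 - α * Qi))) * (1 * N)) := by
        rw [one_mul]
        refine mul_le_mul_right (h.trans ?_) _
        gcongr
        exacts [hv j Qi hQi0, hv k _ hQi1]
    _ = _ := by
        rw [hone]
        simp only [← mul_assoc]
        rw [← ENNReal.ofReal_mul (by positivity), ← ENNReal.ofReal_mul (by positivity),
          ← ENNReal.ofReal_mul (by positivity), ← ENNReal.ofReal_mul (by positivity)]
        congr 3
        have e : (j : ℝ) * (s + n * Qi) + (k : ℝ) * (n - (s' + n * α * Qi)) =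
          (j : ℝ) * s + (j : ℝ) * n * Qi + (k : ℝ) * n * (1 - α * Qi) + -((k : ℝ) * s') := by ring
        rw [e, Real.rpow_add (by norm_num), Real.rpow_add (by norm_num),
          Real.rpow_add (by norm_num)]
        ring

/-- The annulus-to-annulus estimate for the heat flow. For times below the square of the larger
scale it combines the off-diagonal bound of the Gauss kernel (distant annuli) with the smoothing
estimate (equal or adjacent annuli); for larger times it uses the bound `t ^ (-n / 2)`. -/
theorem herzPiece_heat_le {α : ℝ} (hα : 1 < α) {q : ℝ≥0∞}
    (hq : ENNReal.ofReal α ≤ q) {s s' β : ℝ} (hβ : β = s + n * (1 / q).toReal)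
    (hs' : s' + n * (α * (1 / q).toReal) = β + 2) (hβ0 : 0 ≤ β) (hβn : β + 2 ≤ n) :
    ∃ C : ℝ, 0 < C ∧ ∀ (j k : ℤ) (t : ℝ), 0 < t →
      ∀ f : EuclideanSpace ℝ (Fin n) → 𝕜, AEStronglyMeasurable f volume →
      herzPiece s q (heat t ((annulus n k).indicator f)) j ≤
        ENNReal.ofReal (C * annulusKernel n β ((n : ℝ) / 2 * (α - 1) * (1 / q).toReal) j k t) *
        herzPiece s' (q / ENNReal.ofReal α) f k := by
  obtain ⟨C₁, hC₁, h₁⟩ := herzPiece_heat_le_of_kernel_le (n := n) (𝕜 := 𝕜) hα hq s s'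
  set Qi := (1 / q).toReal with hQi
  have hQi0 : 0 ≤ Qi := ENNReal.toReal_nonneg
  set θ := (n : ℝ) / 2 * (α - 1) * Qi with hθ
  have hn0 : (0 : ℝ) ≤ n := n.cast_nonneg
  have hθ0 : 0 ≤ θ := by
    have : 0 ≤ α - 1 := by linarith
    positivity
  rw [← hβ, hs'] at h₁
  set K : ℝ := n.factorial * Real.exp 1 * (2 : ℝ) ^ (2 * (n : ℝ)) with hK
  have hK0 : 0 < K := by positivity
  set D : ℝ := (2 : ℝ) ^ (|s| + 2 + n) with hD
  have hD0 : 0 < D := by positivity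
  refine ⟨C₁ + C₁ * K + D, by positivity, fun j k t ht f hf => ?_⟩
  set l : ℤ := max j k with hl
  set y : ℝ := t * (2 : ℝ) ^ (-(2 * (l : ℝ))) with hy
  have hy0 : 0 < y := by positivity
  have ht' : t = y * (2 : ℝ) ^ (2 * (l : ℝ)) := by
    rw [hy, mul_assoc, ← Real.rpow_add (by norm_num), neg_add_cancel, Real.rpow_zero, mul_one]
  set P : ℝ := (2 : ℝ) ^ ((j : ℝ) * β + (k : ℝ) * (n - β - 2) - (l : ℝ) * n) with hP
  have hP0 : 0 < P := by positivity
  have hker : annulusKernel n β θ j k t = P * timeProfile n θ y := rfl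
  have hψ0 : 0 ≤ timeProfile n θ y := timeProfile_nonneg n θ hy0.le
  -- enlarge the constant of a bound of the right shape
  have fin : ∀ a : ℝ, 0 ≤ a → a ≤ C₁ + C₁ * K + D → ∀ B : ℝ, B ≤ a * (P * timeProfile n θ y) →
      herzPiece s q (heat t ((annulus n k).indicator f)) j ≤
        ENNReal.ofReal B * herzPiece s' (q / ENNReal.ofReal α) f k →
      herzPiece s q (heat t ((annulus n k).indicator f)) j ≤
        ENNReal.ofReal ((C₁ + C₁ * K + D) * annulusKernel n β θ j k t) *
        herzPiece s' (q / ENNReal.ofReal α) f k := by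
    intro a ha haC B hB hle
    refine hle.trans ?_
    gcongr
    rw [hker]
    exact hB.trans (by gcongr)
  have hCK : 0 < C₁ * K := by positivity
  have hsplit : (2 : ℝ) ^ ((j : ℝ) * β + (k : ℝ) * (n - (β + 2))) = P * (2 : ℝ) ^ ((l : ℝ) * n) := by
    rw [hP, ← Real.rpow_add (by norm_num)]; congr 1; ring
  by_cases hy1 : y ≤ 1
  · by_cases hjk : 2 ≤ |j - k|
    · -- distant annuli: the kernel is bounded off the diagonal
      refine fin (C₁ * K) hCK.le (by linarith) _ ?_
        (h₁ j k t (K * (2 : ℝ) ^ (-((l : ℝ) * n))) (by positivity) (fun x hx z hz => ?_) f hf)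
      · rw [hsplit, timeProfile, if_pos hy1]
        have e : C₁ * (K * (2 : ℝ) ^ (-((l : ℝ) * n))) * (P * (2 : ℝ) ^ ((l : ℝ) * n)) =
            C₁ * K * (P * 1) := by
          rw [Real.rpow_neg (by norm_num)]; field_simp
        rw [e]
        gcongr
        exact Real.one_le_rpow_of_pos_of_le_one_of_nonpos hy0 hy1 (by linarith)
      · refine (heatKernel_le_norm ht (by positivity) (le_norm_sub_of_mem_annulus hjk hx hz)).trans
          (le_of_eq ?_)
        rw [← hl, hK, mul_assoc (_ * _), ← Real.rpow_add (by norm_num), ← Real.rpow_intCast,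
          ← Real.rpow_mul (by norm_num)]
        congr 2
        push_cast; ring
    · -- adjacent annuli, small time: smoothing of the heat semigroup
      refine fin D hD0.le (by linarith) ((2 : ℝ) ^ ((j : ℝ) * s) * t ^ (-θ) *
        (2 : ℝ) ^ (-((k : ℝ) * s'))) ?_ ?_
      · rw [timeProfile, if_pos hy1, ht', Real.mul_rpow hy0.le (by positivity),
          ← Real.rpow_mul (by norm_num), hD, hP]
        have e1 : (2 : ℝ) ^ ((j : ℝ) * s) * (y ^ (-θ) * (2 : ℝ) ^ (2 * (l : ℝ) * -θ)) *
            (2 : ℝ) ^ (-((k : ℝ) * s')) =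
            (2 : ℝ) ^ ((j : ℝ) * s + 2 * (l : ℝ) * -θ + -((k : ℝ) * s')) * y ^ (-θ) := by
          rw [Real.rpow_add (by norm_num), Real.rpow_add (by norm_num)]; ring
        rw [e1, ← mul_assoc, ← Real.rpow_add (by norm_num)]
        refine mul_le_mul_of_nonneg_right
          (Real.rpow_le_rpow_of_exponent_le (by norm_num) ?_) (by positivity)
        have hsθ : s' = s + 2 - 2 * θ := by rw [hθ]; linarith
        rw [hsθ]
        have habs := abs_le.1 (le_refl |s|)
        have hcases : j = k ∨ j = k + 1 ∨ j = k - 1 := by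
          have := abs_lt.1 (not_le.1 hjk)
          omega
        rcases hcases with h | h | h
        · have : l = k := by omega
          rw [this, h]
          nlinarith
        · have : l = k + 1 := by omega
          rw [this, h]
          push_cast
          nlinarith
        · have : l = k := by omega
          rw [this, h]
          push_cast
          nlinarith
      · exact herzPiece_heat_le_smoothing hα hq s s' ht j k hf
  · -- large time: the kernel is bounded by `t ^ (-n / 2)`
    refine fin C₁ hC₁.le (by linarith) _ ?_
      (h₁ j k t (t ^ (-(n : ℝ) / 2)) (by positivity) (fun x _ z _ => heatKernel_le ht _) f hf)
    rw [hsplit, timeProfile, if_neg hy1, ht', Real.mul_rpow hy0.le (by positivity),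
      ← Real.rpow_mul (by norm_num)]
    have e : (2 : ℝ) ^ (2 * (l : ℝ) * (-(n : ℝ) / 2)) * (2 : ℝ) ^ ((l : ℝ) * n) = 1 := by
      rw [← Real.rpow_add (by norm_num)]
      convert! Real.rpow_zero _ using 2
      ring
    refine le_of_eq ?_
    calc _ = C₁ * (P * y ^ (-(n : ℝ) / 2)) *
          ((2 : ℝ) ^ (2 * (l : ℝ) * (-(n : ℝ) / 2)) * (2 : ℝ) ^ ((l : ℝ) * n)) := by ring
      _ = _ := by rw [e, mul_one]

/-! ### Time integrals of the annulus kernel -/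

theorem measurable_timeProfile (n : ℕ) (θ : ℝ) : Measurable (timeProfile n θ) :=
  Measurable.ite measurableSet_Iic (measurable_id.pow_const _) (measurable_id.pow_const _)

theorem measurable_annulusKernel (n : ℕ) (β θ : ℝ) (j k : ℤ) :
    Measurable (annulusKernel n β θ j k) :=
  measurable_const.mul ((measurable_timeProfile n θ).comp (measurable_id.mul_const _))

theorem lintegral_timeProfile_ne_top {n : ℕ} (hn : 3 ≤ n) {θ : ℝ} (hθ : θ < 1) :
    ∫⁻ y in Ioi (0 : ℝ), ENNReal.ofReal (timeProfile n θ y) ≠ ∞ := by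
  have hn' : (3 : ℝ) ≤ n := by exact_mod_cast hn
  have h1 : IntegrableOn (timeProfile n θ) (Ioc 0 1) := by
    have : IntegrableOn (fun y : ℝ => y ^ (-θ)) (Ioc 0 1) := by
      rw [← intervalIntegrable_iff_integrableOn_Ioc_of_le zero_le_one]
      exact intervalIntegral.intervalIntegrable_rpow' (by linarith)
    exact this.congr_fun (fun y hy => by simp [timeProfile, hy.2]) measurableSet_Ioc
  have h2 : IntegrableOn (timeProfile n θ) (Ioi 1) := by
    have : IntegrableOn (fun y : ℝ => y ^ (-(n : ℝ) / 2)) (Ioi 1) :=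
      integrableOn_Ioi_rpow_of_lt (by linarith) zero_lt_one
    exact this.congr_fun (fun y hy => by simp [timeProfile, not_le.2 (mem_Ioi.1 hy)])
      measurableSet_Ioi
  have h3 := h1.union h2
  rw [Ioc_union_Ioi_eq_Ioi zero_le_one] at h3
  refine ne_top_of_le_ne_top h3.2.ne (lintegral_mono fun y => ?_)
  exact Real.ofReal_le_enorm _

/-- The mass of the time profile on `(0, x)`. -/
noncomputable def profileMass (n : ℕ) (θ x : ℝ) : ℝ≥0∞ :=
  ∫⁻ y in Ioo 0 x, ENNReal.ofReal (timeProfile n θ y)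

theorem profileMass_mono (n : ℕ) (θ : ℝ) : Monotone (profileMass n θ) := fun _ _ h =>
  lintegral_mono_set (Ioo_subset_Ioo_right h)

theorem tendsto_profileMass {n : ℕ} (hn : 3 ≤ n) {θ : ℝ} (hθ : θ < 1) :
    Tendsto (profileMass n θ) (𝓝[>] 0) (𝓝 0) := by
  have h := tendsto_setLIntegral_zero (μ := volume.restrict (Ioi (0 : ℝ)))
    (lintegral_timeProfile_ne_top hn hθ) (l := 𝓝[>] (0 : ℝ)) (s := fun x => Ioo 0 x) ?_
  · refine h.congr fun x => ?_
    rw [Measure.restrict_restrict measurableSet_Ioo, profileMass,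
      inter_eq_left.2 fun y hy => hy.1]
  · have h0 : Tendsto (fun x : ℝ => ENNReal.ofReal x) (𝓝[>] 0) (𝓝 0) := by
      have := (ENNReal.continuous_ofReal.tendsto 0).mono_left
        (nhdsWithin_le_nhds (a := (0 : ℝ)) (s := Ioi 0))
      simpa using this
    refine tendsto_of_tendsto_of_tendsto_of_le_of_le tendsto_const_nhds h0
      (fun _ => zero_le) fun x => ?_
    refine (Measure.restrict_apply_le _ _).trans ?_
    simp

/-- Scaling of the time integral of the profile. -/
theorem lintegral_timeProfile_scale (n : ℕ) (θ : ℝ) {a : ℝ} (ha : 0 < a) (δ : ℝ) :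
    ∫⁻ t in Ioo 0 δ, ENNReal.ofReal (a * timeProfile n θ (t * a)) = profileMass n θ (δ * a) := by
  set g : ℝ → ℝ≥0∞ := (Ioo 0 (δ * a)).indicator fun y => ENNReal.ofReal (timeProfile n θ y) with hg
  have hgm : Measurable g :=
    (measurable_timeProfile n θ).ennreal_ofReal.indicator measurableSet_Ioo
  have h1 : profileMass n θ (δ * a) = ∫⁻ y, g y := by
    rw [hg, lintegral_indicator measurableSet_Ioo, profileMass]
  have h2 : ∫⁻ y, g y = ENNReal.ofReal |a| * ∫⁻ t, g (t * a) := by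
    conv_lhs => rw [← Real.smul_map_volume_mul_right ha.ne', lintegral_smul_measure,
      lintegral_map hgm (measurable_mul_const a), smul_eq_mul]
  rw [h1, h2, ← lintegral_const_mul' _ _ ENNReal.ofReal_ne_top,
    ← lintegral_indicator measurableSet_Ioo]
  refine lintegral_congr fun t => ?_
  have hiff : t * a ∈ Ioo 0 (δ * a) ↔ t ∈ Ioo 0 δ := by
    simp only [mem_Ioo, mul_lt_mul_iff_left₀ ha, mul_pos_iff_of_pos_right ha]
  by_cases ht : t ∈ Ioo 0 δ
  · rw [indicator_of_mem ht, hg, indicator_of_mem (hiff.2 ht), abs_of_pos ha,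
      ENNReal.ofReal_mul ha.le]
  · rw [indicator_of_notMem ht, hg, indicator_of_notMem (mt hiff.1 ht), mul_zero]

/-- The off-diagonal decay of the time integral of `annulusKernel`: the factor which remains when
the time profile is normalized to have a mass independent of the scale. -/
noncomputable def annulusWeight (n : ℕ) (β : ℝ) (j k : ℤ) : ℝ :=
  (2 : ℝ) ^ ((j : ℝ) * β + (k : ℝ) * (n - β - 2) - ((max j k : ℤ) : ℝ) * n +
    2 * ((max j k : ℤ) : ℝ))

theorem annulusKernel_eq (n : ℕ) (β θ : ℝ) (j k : ℤ) (t : ℝ) :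
    annulusKernel n β θ j k t = annulusWeight n β j k *
      ((2 : ℝ) ^ (-(2 * ((max j k : ℤ) : ℝ))) *
        timeProfile n θ (t * (2 : ℝ) ^ (-(2 * ((max j k : ℤ) : ℝ))))) := by
  rw [annulusKernel, annulusWeight, ← mul_assoc, ← Real.rpow_add (by norm_num)]
  congr 2; ring

theorem annulusWeight_le {n : ℕ} {β ν : ℝ} (h1 : ν ≤ β) (h2 : ν ≤ n - β - 2) (j k : ℤ) :
    annulusWeight n β j k ≤ (2 : ℝ) ^ (-(|((k - j : ℤ) : ℝ)| * ν)) := by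
  apply Real.rpow_le_rpow_of_exponent_le (by norm_num)
  rcases le_total j k with h | h
  · rw [max_eq_right h]
    have h' : (0 : ℝ) ≤ ((k - j : ℤ) : ℝ) := by exact_mod_cast sub_nonneg.2 h
    rw [abs_of_nonneg h']
    push_cast at h' ⊢
    nlinarith
  · rw [max_eq_left h]
    have h' : ((k - j : ℤ) : ℝ) ≤ 0 := by exact_mod_cast sub_nonpos.2 h
    rw [abs_of_nonpos h']
    push_cast at h' ⊢
    nlinarith

theorem lintegral_annulusKernel (n : ℕ) (β θ : ℝ) (j k : ℤ) (δ : ℝ) :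
    ∫⁻ t in Ioo 0 δ, ENNReal.ofReal (annulusKernel n β θ j k t) =
      ENNReal.ofReal (annulusWeight n β j k) *
        profileMass n θ (δ * (2 : ℝ) ^ (-(2 * ((max j k : ℤ) : ℝ)))) := by
  have hw : 0 ≤ annulusWeight n β j k := by unfold annulusWeight; positivity
  simp_rw [annulusKernel_eq, ENNReal.ofReal_mul hw]
  rw [lintegral_const_mul' _ _ ENNReal.ofReal_ne_top,
    lintegral_timeProfile_scale n θ (by positivity)]

theorem tsum_two_rpow_neg_abs_mul_ne_top {ν : ℝ} (hν : 0 < ν) :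
    ∑' d : ℤ, ENNReal.ofReal ((2 : ℝ) ^ (-(|(d : ℝ)| * ν))) ≠ ∞ := by
  have hs : Summable fun d : ℤ => (2 : ℝ) ^ (-(|(d : ℝ)| * ν)) := by
    have h0 : Summable fun m : ℕ => ((2 : ℝ) ^ (-ν)) ^ m :=
      summable_geometric_of_lt_one (by positivity)
        (Real.rpow_lt_one_of_one_lt_of_neg (by norm_num) (by linarith))
    have h1 : ∀ m : ℕ, (2 : ℝ) ^ (-((m : ℝ) * ν)) = ((2 : ℝ) ^ (-ν)) ^ m := fun m => by
      rw [← Real.rpow_natCast, ← Real.rpow_mul (by norm_num)]; congr 1; ring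
    refine Summable.of_nat_of_neg ?_ ?_
    · simpa [h1] using h0
    · simpa [h1] using h0
  exact hs.tsum_ofReal_ne_top

theorem tsum_two_rpow_neg_abs_sub_mul (ν : ℝ) (j : ℤ) :
    ∑' k : ℤ, ENNReal.ofReal ((2 : ℝ) ^ (-(|((k - j : ℤ) : ℝ)| * ν))) =
      ∑' d : ℤ, ENNReal.ofReal ((2 : ℝ) ^ (-(|(d : ℝ)| * ν))) :=
  (Equiv.subRight j).tsum_eq fun d : ℤ => ENNReal.ofReal ((2 : ℝ) ^ (-(|(d : ℝ)| * ν)))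

/-- `annulusKernel`, as a family of operators on sequences, maps sequences of finite `N`-size to
bounded sequences, by means of a majorant `M` whose time integrals over `(0, δ)` are bounded. -/
def KernelMajorant (n : ℕ) (β θ : ℝ) (N : (ℤ → ℝ≥0∞) → ℝ≥0∞) : Prop :=
  ∃ (M : ℤ → ℝ → ℝ≥0∞) (C : ℝ≥0∞), C ≠ ∞ ∧ (∀ j, Measurable (M j)) ∧
    (∀ j δ, ∫⁻ t in Ioo 0 δ, M j t ≤ C) ∧
    ∀ j t b, ∑' k, ENNReal.ofReal (annulusKernel n β θ j k t) * b k ≤ M j t * N b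

theorem profileMass_le {n : ℕ} {θ : ℝ} (x : ℝ) :
    profileMass n θ x ≤ ∫⁻ y in Ioi (0 : ℝ), ENNReal.ofReal (timeProfile n θ y) :=
  lintegral_mono_set fun _ hy => hy.1

/-- Below the critical line `β + 2 = n` the weights decay geometrically on both sides of the
diagonal. -/
theorem kernelMajorant_iSup {n : ℕ} (hn : 3 ≤ n) {β θ : ℝ} (hθ : θ < 1) (hβ : 0 < β)
    (hβn : β + 2 < n) : KernelMajorant n β θ fun b => ⨆ k, b k := by
  set ν := min β (n - β - 2) with hν
  have hν0 : 0 < ν := lt_min hβ (by linarith)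
  refine ⟨fun j t => ∑' k, ENNReal.ofReal (annulusKernel n β θ j k t),
    (∑' d : ℤ, ENNReal.ofReal ((2 : ℝ) ^ (-(|(d : ℝ)| * ν)))) *
      ∫⁻ y in Ioi (0 : ℝ), ENNReal.ofReal (timeProfile n θ y),
    ENNReal.mul_ne_top (tsum_two_rpow_neg_abs_mul_ne_top hν0) (lintegral_timeProfile_ne_top hn hθ),
    fun j => Measurable.tsum fun k => (measurable_annulusKernel n β θ j k).ennreal_ofReal,
    fun j δ => ?_, fun j t b => ?_⟩
  · rw [lintegral_tsum fun k => (measurable_annulusKernel n β θ j k).ennreal_ofReal.aemeasurable]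
    rw [← tsum_two_rpow_neg_abs_sub_mul ν j, ← ENNReal.tsum_mul_right]
    refine ENNReal.tsum_le_tsum fun k => ?_
    rw [lintegral_annulusKernel]
    gcongr
    exacts [annulusWeight_le (min_le_left _ _) (min_le_right _ _) j k, profileMass_le _]
  · rw [← ENNReal.tsum_mul_right]
    refine ENNReal.tsum_le_tsum fun k => ?_
    gcongr
    exact le_iSup b k

/-- On the critical line `β + 2 = n` there is no decay for `k ≤ j`, but there the kernel does not
depend on `k`, and it acts on summable sequences. -/
theorem kernelMajorant_tsum {n : ℕ} (hn : 3 ≤ n) {β θ : ℝ} (hθ : θ < 1) (hβ : 0 < β)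
    (hβn : β + 2 = n) : KernelMajorant n β θ fun b => ∑' k, b k := by
  set I := ∫⁻ y in Ioi (0 : ℝ), ENNReal.ofReal (timeProfile n θ y) with hI
  set G := ∑' d : ℤ, ENNReal.ofReal ((2 : ℝ) ^ (-(|(d : ℝ)| * β))) with hG
  -- the kernel does not depend on `k` for `k ≤ j`, and it is summable over `k > j`
  have hdiag : ∀ j k t, k ≤ j → annulusKernel n β θ j k t = annulusKernel n β θ j j t := by
    intro j k t h
    have : (n : ℝ) - β - 2 = 0 := by linarith
    rw [annulusKernel, annulusKernel, max_eq_left h, max_self, this, mul_zero, mul_zero]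
  have hm : ∀ j k, Measurable fun t =>
      if j < k then ENNReal.ofReal (annulusKernel n β θ j k t) else 0 := fun j k => by
    split_ifs
    exacts [(measurable_annulusKernel n β θ j k).ennreal_ofReal, measurable_const]
  refine ⟨fun j t => ENNReal.ofReal (annulusKernel n β θ j j t) +
      ∑' k, if j < k then ENNReal.ofReal (annulusKernel n β θ j k t) else 0, I + G * I,
    ENNReal.add_ne_top.2 ⟨lintegral_timeProfile_ne_top hn hθ, ENNReal.mul_ne_top
      (tsum_two_rpow_neg_abs_mul_ne_top hβ) (lintegral_timeProfile_ne_top hn hθ)⟩,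
    fun j => (measurable_annulusKernel n β θ j j).ennreal_ofReal.add
      (Measurable.tsum (hm j)), fun j δ => ?_, fun j t b => ?_⟩
  · rw [lintegral_add_left (measurable_annulusKernel n β θ j j).ennreal_ofReal,
      lintegral_tsum fun k => (hm j k).aemeasurable]
    gcongr
    · rw [lintegral_annulusKernel]
      have h1 : annulusWeight n β j j ≤ 1 := by
        refine (annulusWeight_le (ν := 0) hβ.le (by linarith) j j).trans_eq ?_
        simp
      calc _ ≤ ENNReal.ofReal 1 * I := by
            gcongr
            exact profileMass_le _
        _ = I := by simp
    · rw [hG, ← tsum_two_rpow_neg_abs_sub_mul β j, ← ENNReal.tsum_mul_right]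
      refine ENNReal.tsum_le_tsum fun k => ?_
      split_ifs with hjk
      · rw [lintegral_annulusKernel]
        gcongr
        · refine Real.rpow_le_rpow_of_exponent_le (by norm_num) ?_
          have h' : (0 : ℝ) ≤ ((k - j : ℤ) : ℝ) := by exact_mod_cast sub_nonneg.2 hjk.le
          rw [abs_of_nonneg h', max_eq_right hjk.le, ← hβn]
          push_cast
          linarith
        · exact profileMass_le _
      · simp
  · rw [← ENNReal.tsum_mul_left]
    refine ENNReal.tsum_le_tsum fun k => ?_
    gcongr
    rcases le_or_gt k j with h | h
    · rw [hdiag j k t h]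
      exact le_self_add
    · refine le_trans ?_ le_add_self
      refine le_trans (by rw [if_pos h]) (ENNReal.le_tsum k)

theorem exists_pos_mul_le {C ε : ℝ≥0∞} (hC : C ≠ ∞) (hε : 0 < ε) :
    ∃ η : ℝ≥0∞, 0 < η ∧ C * η ≤ ε := by
  have h : Tendsto (fun η : ℝ≥0∞ => C * η) (𝓝 0) (𝓝 (C * 0)) :=
    ENNReal.Tendsto.const_mul tendsto_id (Or.inr hC)
  rw [mul_zero] at h
  have h2 := (h.eventually_le_const hε).filter_mono (nhdsWithin_le_nhds (s := Ioi 0))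
  obtain ⟨η, h3, h4⟩ := (h2.and self_mem_nhdsWithin).exists
  exact ⟨η, h4, h3⟩

/-- Sequences which are `N`-small off a finite set are mapped to sequences which are small after
integration over a short time, uniformly in the target annulus. -/
theorem KernelMajorant.exists_small {n : ℕ} (hn : 3 ≤ n) {β θ : ℝ} (hθ : θ < 1) (hβ : 0 ≤ β)
    (hβn : β + 2 ≤ n) {N : (ℤ → ℝ≥0∞) → ℝ≥0∞} (hN : KernelMajorant n β θ N)
    {ε : ℝ≥0∞} (hε : 0 < ε) :
    ∃ η : ℝ≥0∞, 0 < η ∧ ∀ (S : Finset ℤ) (B : ℝ≥0∞), B ≠ ∞ → ∃ δ : ℝ, 0 < δ ∧ ∀ j,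
      ∃ c : ℝ → ℝ≥0∞, Measurable c ∧ ∫⁻ t in Ioo 0 δ, c t ≤ ε ∧
        ∀ t (b : ℤ → ℝ≥0∞), N (fun k => if k ∈ S then 0 else b k) ≤ η → (∀ k ∈ S, b k ≤ B) →
          ∑' k, ENNReal.ofReal (annulusKernel n β θ j k t) * b k ≤ c t := by
  obtain ⟨M, C, hC, hMm, hM, hMb⟩ := hN
  have hε2 : 0 < ε / 2 := ENNReal.half_pos hε.ne'
  obtain ⟨η, hη0, hη⟩ := exists_pos_mul_le hC hε2
  refine ⟨η, hη0, fun S B hB => ?_⟩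
  obtain ⟨δ, hδ0, hδ⟩ : ∃ δ : ℝ, 0 < δ ∧
      B * ∑ k ∈ S, profileMass n θ (δ * (2 : ℝ) ^ (-(2 * (k : ℝ)))) ≤ ε / 2 := by
    have h : ∀ k ∈ S, Tendsto (fun δ : ℝ => profileMass n θ (δ * (2 : ℝ) ^ (-(2 * (k : ℝ)))))
        (𝓝[>] 0) (𝓝 0) := fun k _ => by
      refine (tendsto_profileMass hn hθ).comp ?_
      refine tendsto_nhdsWithin_iff.2 ⟨?_, ?_⟩
      · have : Tendsto (fun δ : ℝ => δ * (2 : ℝ) ^ (-(2 * (k : ℝ)))) (𝓝 0)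
            (𝓝 (0 * (2 : ℝ) ^ (-(2 * (k : ℝ))))) := tendsto_id.mul_const _
        rw [zero_mul] at this
        exact this.mono_left nhdsWithin_le_nhds
      · filter_upwards [self_mem_nhdsWithin] with δ (hδ : 0 < δ)
        exact mul_pos hδ (by positivity)
    have h2 := ENNReal.Tendsto.const_mul (tendsto_finsetSum S h) (Or.inr hB)
    rw [Finset.sum_const_zero, mul_zero] at h2
    obtain ⟨δ, h3, h4⟩ := ((h2.eventually_le_const hε2).and self_mem_nhdsWithin).exists
    exact ⟨δ, h4, h3⟩
  refine ⟨δ, hδ0, fun j => ⟨fun t => M j t * η +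
    B * ∑ k ∈ S, ENNReal.ofReal (annulusKernel n β θ j k t), ?_, ?_, fun t b hb hbB => ?_⟩⟩
  · exact ((hMm j).mul_const _).add ((Finset.measurable_fun_sum _ fun k _ =>
      (measurable_annulusKernel n β θ j k).ennreal_ofReal).const_mul _)
  · rw [lintegral_add_left ((hMm j).mul_const _), lintegral_mul_const _ (hMm j),
      lintegral_const_mul' _ _ hB, lintegral_finsetSum _ fun k _ =>
      (measurable_annulusKernel n β θ j k).ennreal_ofReal, ← ENNReal.add_halves ε]
    gcongr
    · exact le_trans (by gcongr; exact hM j δ) hη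
    · refine le_trans ?_ hδ
      gcongr with k hk
      rw [lintegral_annulusKernel]
      have h1 : annulusWeight n β j k ≤ 1 := by
        refine (annulusWeight_le (ν := 0) hβ (by linarith) j k).trans_eq ?_
        simp
      calc _ ≤ ENNReal.ofReal 1 * profileMass n θ (δ * (2 : ℝ) ^ (-(2 * (k : ℝ)))) := by
            gcongr
            apply profileMass_mono
            gcongr
            · norm_num
            · exact le_max_right j k
        _ = _ := by simp
  · have hsplit : ∀ k, ENNReal.ofReal (annulusKernel n β θ j k t) * b k =
        ENNReal.ofReal (annulusKernel n β θ j k t) * (if k ∈ S then 0 else b k) +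
        (if k ∈ S then ENNReal.ofReal (annulusKernel n β θ j k t) * b k else 0) := fun k => by
      split_ifs <;> simp
    rw [tsum_congr hsplit, ENNReal.tsum_add]
    refine add_le_add ?_ ?_
    · exact (hMb j t _).trans (by gcongr)
    · rw [tsum_eq_sum (s := S) fun k hk => by simp [hk], Finset.mul_sum]
      refine Finset.sum_le_sum fun k hk => ?_
      rw [if_pos hk, mul_comm]
      gcongr
      exact hbB k hk

/-! ### The nonlinear term and the Herz pieces -/

theorem aestronglyMeasurable_nonlin (γ α : ℝ) {v : EuclideanSpace ℝ (Fin n) → 𝕜}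
    (hv : AEStronglyMeasurable v volume) : AEStronglyMeasurable (nonlin γ α v) volume := by
  have h1 : AEMeasurable (fun x : EuclideanSpace ℝ (Fin n) => ‖x‖ ^ γ) volume :=
    (measurable_norm.pow_const γ).aemeasurable
  have h2 : AEMeasurable (fun x => ‖v x‖ ^ (α - 1)) volume := hv.norm.aemeasurable.pow_const _
  exact (h1.mul h2).aestronglyMeasurable.smul hv

theorem nonlin_congr_ae (γ α : ℝ) {v w : EuclideanSpace ℝ (Fin n) → 𝕜} (h : v =ᵐ[volume] w) :
    nonlin γ α v =ᵐ[volume] nonlin γ α w := by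
  filter_upwards [h] with x hx
  simp only [nonlin, hx]

theorem norm_nonlin_sub_le {γ α : ℝ} (hα : 1 < α) (u v : EuclideanSpace ℝ (Fin n) → 𝕜)
    (x : EuclideanSpace ℝ (Fin n)) :
    ‖nonlin γ α u x - nonlin γ α v x‖ ≤
      α * ‖x‖ ^ γ * ((‖u x‖ ^ (α - 1) + ‖v x‖ ^ (α - 1)) * ‖u x - v x‖) := by
  have h := norm_rpow_smul_sub_le (p := α - 1) (by linarith) (u x) (v x)
  have hx : 0 ≤ ‖x‖ ^ γ := by positivity
  rw [nonlin, nonlin, mul_smul, mul_smul, ← smul_sub, norm_smul, Real.norm_of_nonneg hx]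
  calc _ ≤ ‖x‖ ^ γ * ((1 + (α - 1)) * (‖u x‖ ^ (α - 1) + ‖v x‖ ^ (α - 1)) * ‖u x - v x‖) := by
        gcongr
    _ = _ := by ring

theorem norm_rpow_le_of_mem_annulus (γ : ℝ) {k : ℤ} {x : EuclideanSpace ℝ (Fin n)}
    (hx : x ∈ annulus n k) : ‖x‖ ^ γ ≤ (2 : ℝ) ^ |γ| * (2 : ℝ) ^ ((k : ℝ) * γ) := by
  have h0 : (0 : ℝ) < (2 : ℝ) ^ (k - 1) := by positivity
  have hx0 : 0 < ‖x‖ := h0.trans_le hx.1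
  have e : ∀ i : ℤ, ((2 : ℝ) ^ i) ^ γ = (2 : ℝ) ^ ((i : ℝ) * γ) := fun i => by
    rw [Real.rpow_mul (by norm_num), Real.rpow_intCast]
  rw [← Real.rpow_add (by norm_num)]
  rcases le_total 0 γ with h | h
  · refine (Real.rpow_le_rpow hx0.le hx.2.le h).trans ?_
    rw [e]
    apply Real.rpow_le_rpow_of_exponent_le (by norm_num)
    have := abs_nonneg γ
    linarith
  · refine (Real.rpow_le_rpow_of_nonpos h0 hx.1 h).trans ?_
    rw [e]
    apply Real.rpow_le_rpow_of_exponent_le (by norm_num)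
    rw [abs_of_nonpos h]
    push_cast
    linarith

/-- Hölder's inequality for `|u|^p |w|`, with exponents `q / p`, `q` and `q / (p + 1)`. -/
theorem eLpNorm_norm_rpow_smul_le {X F G : Type*} [MeasurableSpace X] [NormedAddCommGroup F]
    [NormedAddCommGroup G] {μ : Measure X} {α : ℝ} (hα : 1 < α) {q : ℝ≥0∞}
    {u : X → F} {w : X → G} (hu : AEStronglyMeasurable u μ) (hw : AEStronglyMeasurable w μ) :
    eLpNorm (fun x => ‖u x‖ ^ (α - 1) * ‖w x‖) (q / ENNReal.ofReal α) μ ≤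
      eLpNorm u q μ ^ (α - 1) * eLpNorm w q μ := by
  have hp : 0 < α - 1 := by linarith
  have hp0 : ENNReal.ofReal (α - 1) ≠ 0 := by simpa using hp
  have hα0 : ENNReal.ofReal α ≠ 0 := by simp; linarith
  have htri : ENNReal.HolderTriple (q / ENNReal.ofReal (α - 1)) q (q / ENNReal.ofReal α) := by
    constructor
    rw [ENNReal.inv_div (Or.inl ENNReal.ofReal_ne_top) (Or.inl hp0),
      ENNReal.inv_div (Or.inl ENNReal.ofReal_ne_top) (Or.inl hα0), ← one_div,
      ENNReal.div_add_div_same, ← ENNReal.ofReal_one, ← ENNReal.ofReal_add hp.le zero_le_one,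
      sub_add_cancel]
  have h1 : AEStronglyMeasurable (fun x => ‖u x‖ ^ (α - 1)) μ :=
    (hu.norm.aemeasurable.pow_const _).aestronglyMeasurable
  have h := eLpNorm_smul_le_mul_eLpNorm (μ := μ) hw.norm h1 (hpqr := htri)
  rw [eLpNorm_norm_rpow _ hp, ENNReal.div_mul_cancel hp0 ENNReal.ofReal_ne_top,
    eLpNorm_norm] at h
  exact h

/-- The Lipschitz estimate for the nonlinear term, annulus by annulus. -/
theorem herzPiece_nonlin_sub_le (γ : ℝ) {α : ℝ} (hα : 1 < α) (s : ℝ) {q : ℝ≥0∞}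
    (hq : ENNReal.ofReal α ≤ q) :
    ∃ C : ℝ, 0 < C ∧ ∀ (k : ℤ) (u v : EuclideanSpace ℝ (Fin n) → 𝕜),
      AEStronglyMeasurable u volume → AEStronglyMeasurable v volume →
      herzPiece (α * s - γ) (q / ENNReal.ofReal α) (nonlin γ α u - nonlin γ α v) k ≤
        ENNReal.ofReal C * ((herzPiece s q u k ^ (α - 1) + herzPiece s q v k ^ (α - 1)) *
          herzPiece s q (u - v) k) := by
  have hα0 : 0 < α := by linarith
  have hp : 0 < α - 1 := by linarith
  refine ⟨α * (2 : ℝ) ^ |γ|, by positivity, fun k u v hu hv => ?_⟩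
  set D : ℝ := α * (2 : ℝ) ^ |γ| * (2 : ℝ) ^ ((k : ℝ) * γ) with hD
  have hD0 : 0 ≤ D := by positivity
  have hm := measurableSet_annulus n k
  set uk := (annulus n k).indicator u with huk
  set vk := (annulus n k).indicator v with hvk
  set wk := (annulus n k).indicator (u - v) with hwk
  have hukm : AEStronglyMeasurable uk volume := hu.indicator hm
  have hvkm : AEStronglyMeasurable vk volume := hv.indicator hm
  have hwkm : AEStronglyMeasurable wk volume := (hu.sub hv).indicator hm
  have hpt : ∀ x, ‖(annulus n k).indicator (nonlin γ α u - nonlin γ α v) x‖ ≤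
      ‖(D • ((fun x => ‖uk x‖ ^ (α - 1) * ‖wk x‖) + fun x => ‖vk x‖ ^ (α - 1) * ‖wk x‖)) x‖ := by
    intro x
    by_cases hx : x ∈ annulus n k
    · rw [indicator_of_mem hx]
      have e1 : uk x = u x := indicator_of_mem hx _
      have e2 : vk x = v x := indicator_of_mem hx _
      have e3 : wk x = u x - v x := indicator_of_mem hx _
      simp only [Pi.smul_apply, Pi.add_apply, Pi.sub_apply, e1, e2, e3, smul_eq_mul]
      refine (norm_nonlin_sub_le hα u v x).trans ((le_trans ?_ (le_abs_self _)))
      rw [← add_mul]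
      have hle : α * ‖x‖ ^ γ ≤ D := by
        rw [hD, mul_assoc]
        exact mul_le_mul_of_nonneg_left (norm_rpow_le_of_mem_annulus γ hx) hα0.le
      exact mul_le_mul_of_nonneg_right hle (by positivity)
    · rw [indicator_of_notMem hx, norm_zero]
      positivity
  have hq1 := one_le_div_ofReal hα0 hq
  have hprod : ∀ {a b : EuclideanSpace ℝ (Fin n) → 𝕜}, AEStronglyMeasurable a volume →
      AEStronglyMeasurable b volume →
      AEStronglyMeasurable (fun x => ‖a x‖ ^ (α - 1) * ‖b x‖) volume := fun ha hb =>
    ((ha.norm.aemeasurable.pow_const _).mul hb.norm.aemeasurable).aestronglyMeasurable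
  have h1 : eLpNorm ((annulus n k).indicator (nonlin γ α u - nonlin γ α v))
      (q / ENNReal.ofReal α) volume ≤ ENNReal.ofReal D *
        ((eLpNorm uk q volume ^ (α - 1) + eLpNorm vk q volume ^ (α - 1)) *
          eLpNorm wk q volume) := by
    refine (eLpNorm_mono hpt).trans ?_
    rw [eLpNorm_const_smul, Real.enorm_of_nonneg hD0, add_mul]
    gcongr
    refine (eLpNorm_add_le (hprod hukm hwkm) (hprod hvkm hwkm) hq1).trans ?_
    gcongr
    exacts [eLpNorm_norm_rpow_smul_le hα hukm hwkm, eLpNorm_norm_rpow_smul_le hα hvkm hwkm]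
  unfold herzPiece
  rw [← huk, ← hvk, ← hwk, ENNReal.mul_rpow_of_nonneg _ _ hp.le,
    ENNReal.mul_rpow_of_nonneg _ _ hp.le, ENNReal.ofReal_rpow_of_pos (by positivity),
    ← Real.rpow_mul (by norm_num)]
  refine (mul_le_mul_right h1 _).trans (le_of_eq ?_)
  rw [← mul_assoc, ← ENNReal.ofReal_mul (by positivity), ← mul_add]
  have e : (2 : ℝ) ^ ((k : ℝ) * (α * s - γ)) * D =
      α * (2 : ℝ) ^ |γ| * ((2 : ℝ) ^ ((k : ℝ) * s * (α - 1)) * (2 : ℝ) ^ ((k : ℝ) * s)) := by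
    rw [hD, ← Real.rpow_add (by norm_num),
      show (k : ℝ) * s * (α - 1) + k * s = k * (α * s - γ) + k * γ by ring,
      Real.rpow_add (by norm_num)]
    ring
  rw [e, ENNReal.ofReal_mul (by positivity),
    ENNReal.ofReal_mul (p := (2 : ℝ) ^ ((k : ℝ) * s * (α - 1))) (by positivity)]
  ring

theorem herzPiece_congr_ae (s : ℝ) (q : ℝ≥0∞) {f g : EuclideanSpace ℝ (Fin n) → 𝕜}
    (h : f =ᵐ[volume] g) (k : ℤ) : herzPiece s q f k = herzPiece s q g k := by
  unfold herzPiece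
  rw [eLpNorm_congr_ae (h.indicator)]

theorem herzPiece_add_le (s : ℝ) {q : ℝ≥0∞} (hq : 1 ≤ q) {f g : EuclideanSpace ℝ (Fin n) → 𝕜}
    (hf : AEStronglyMeasurable f volume) (hg : AEStronglyMeasurable g volume) (k : ℤ) :
    herzPiece s q (f + g) k ≤ herzPiece s q f k + herzPiece s q g k := by
  unfold herzPiece
  rw [← mul_add, indicator_add']
  gcongr
  exact eLpNorm_add_le (hf.indicator (measurableSet_annulus n k))
    (hg.indicator (measurableSet_annulus n k)) hq

theorem herzPiece_sub_comm (s : ℝ) (q : ℝ≥0∞) (f g : EuclideanSpace ℝ (Fin n) → 𝕜) (k : ℤ) :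
    herzPiece s q (f - g) k = herzPiece s q (g - f) k := by
  unfold herzPiece
  congr 1
  rw [← neg_sub g f, indicator_neg', eLpNorm_neg]

theorem herzPiece_sub_le_sub_add_sub (s : ℝ) {q : ℝ≥0∞} (hq : 1 ≤ q)
    {f g h : EuclideanSpace ℝ (Fin n) → 𝕜}
    (hf : AEStronglyMeasurable f volume) (hg : AEStronglyMeasurable g volume)
    (hh : AEStronglyMeasurable h volume) (k : ℤ) :
    herzPiece s q (f - h) k ≤ herzPiece s q (f - g) k + herzPiece s q (g - h) k := by
  rw [← sub_add_sub_cancel f g h]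
  exact herzPiece_add_le s hq (hf.sub hg) (hg.sub hh) k

theorem herzPiece_le_sub_add (s : ℝ) {q : ℝ≥0∞} (hq : 1 ≤ q)
    {f g : EuclideanSpace ℝ (Fin n) → 𝕜}
    (hf : AEStronglyMeasurable f volume) (hg : AEStronglyMeasurable g volume) (k : ℤ) :
    herzPiece s q f k ≤ herzPiece s q (f - g) k + herzPiece s q g k := by
  simpa using herzPiece_add_le s hq (hf.sub hg) hg k

theorem herzPiece_le_herzNorm (s : ℝ) (q : ℝ≥0∞) {r : ℝ≥0∞} (hr : 0 < r)
    (f : EuclideanSpace ℝ (Fin n) → 𝕜) (k : ℤ) : herzPiece s q f k ≤ herzNorm s q r f := by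
  unfold herzNorm
  split_ifs with h
  · exact le_iSup (herzPiece s q f) k
  · rw [one_div, ENNReal.le_rpow_inv_iff (ENNReal.toReal_pos hr.ne' h)]
    exact ENNReal.le_tsum (f := fun k => herzPiece s q f k ^ r.toReal) k

theorem iUnion_annulus (n : ℕ) : ⋃ k, annulus n k = {0}ᶜ := by
  ext x
  simp only [mem_iUnion, mem_compl_iff, mem_singleton_iff]
  constructor
  · rintro ⟨k, hk⟩ rfl
    have : (0 : ℝ) < (2 : ℝ) ^ (k - 1) := by positivity
    have h2 := hk.1
    rw [norm_zero] at h2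
    linarith
  · intro hx
    obtain ⟨k, h1, h2⟩ := exists_mem_Ico_zpow (norm_pos_iff.2 hx) (one_lt_two (α := ℝ))
    exact ⟨k + 1, by simpa using h1, h2⟩

theorem pairwise_disjoint_annulus (n : ℕ) : Pairwise (Function.onFun Disjoint (annulus n)) := by
  have key : ∀ j k : ℤ, j < k → Disjoint (annulus n j) (annulus n k) := fun j k h => by
    refine Set.disjoint_left.2 fun x hx hy => ?_
    have h1 : (2 : ℝ) ^ j ≤ 2 ^ (k - 1) := zpow_le_zpow_right₀ (by norm_num) (by omega)
    have h2 := hx.2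
    have h3 := hy.1
    linarith
  intro j k hjk
  rcases lt_or_gt_of_ne hjk with h | h
  exacts [key j k h, (key k j h).symm]

theorem ae_mem_iUnion_annulus (hn : 0 < n) : ∀ᵐ x : EuclideanSpace ℝ (Fin n), x ∈ ⋃ k, annulus n k := by
  have : Nonempty (Fin n) := ⟨⟨0, hn⟩⟩
  rw [iUnion_annulus]
  exact compl_mem_ae_iff.2 (measure_singleton _)

theorem ae_eq_zero_of_herzPiece_eq_zero (hn : 0 < n) {s : ℝ} {q : ℝ≥0∞} (hq : q ≠ 0)
    {f : EuclideanSpace ℝ (Fin n) → 𝕜} (hf : AEStronglyMeasurable f volume)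
    (h : ∀ k, herzPiece s q f k = 0) : f =ᵐ[volume] 0 := by
  have h1 : ∀ k, (annulus n k).indicator f =ᵐ[volume] 0 := fun k => by
    have h2 := h k
    rw [herzPiece, mul_eq_zero] at h2
    rcases h2 with h2 | h2
    · rw [ENNReal.ofReal_eq_zero] at h2
      exact absurd h2 (not_le.2 (by positivity))
    · exact (eLpNorm_eq_zero_iff (hf.indicator (measurableSet_annulus n k)) hq).1 h2
  filter_upwards [ae_all_iff.2 h1, ae_mem_iUnion_annulus hn] with x hx hxu
  obtain ⟨k, hk⟩ := mem_iUnion.1 hxu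
  rw [← hx k, indicator_of_mem hk]

theorem volume_annulus_ne_top (n : ℕ) (k : ℤ) : volume (annulus n k) ≠ ∞ := by
  obtain ⟨c, -, hc⟩ := volume_annulus_le n
  exact ne_top_of_le_ne_top ENNReal.ofReal_ne_top (hc k)

/-- On each annulus the `L^1` norm is controlled by the Herz norm. -/
theorem lintegral_indicator_annulus_le (s : ℝ) {q : ℝ≥0∞} (hq : 1 ≤ q) (k : ℤ) :
    ∃ C : ℝ≥0∞, C ≠ ∞ ∧ ∀ f : EuclideanSpace ℝ (Fin n) → 𝕜, AEStronglyMeasurable f volume →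
      ∫⁻ x, ‖(annulus n k).indicator f x‖ₑ ≤ C * herzPiece s q f k := by
  have hq' : (1 / q).toReal ≤ 1 := by
    have := mul_toReal_one_div_le_one (α := 1) one_pos (by simpa using hq)
    linarith
  refine ⟨volume (annulus n k) ^ (1 - (1 / q).toReal) *
      ENNReal.ofReal ((2 : ℝ) ^ (-((k : ℝ) * s))),
    ENNReal.mul_ne_top (ENNReal.rpow_ne_top_of_nonneg (by linarith) (volume_annulus_ne_top n k))
      ENNReal.ofReal_ne_top, fun f hf => ?_⟩
  rw [← eLpNorm_one_eq_lintegral_enorm]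
  refine (eLpNorm_indicator_le_mul_volume (measurableSet_annulus n k) hf hq).trans (le_of_eq ?_)
  unfold herzPiece
  set N := eLpNorm ((annulus n k).indicator f) q volume
  calc _ = volume (annulus n k) ^ (1 - (1 / q).toReal) * 1 * N := by rw [mul_one, mul_comm]
    _ = _ := by rw [one_eq_ofReal_two_rpow_mul ((k : ℝ) * s)]; ring

/-! ### Joint continuity of the heat flow and the Duhamel formula for a difference -/

theorem continuousAt_heatKernel {t : ℝ} (ht : 0 < t) (x : EuclideanSpace ℝ (Fin n)) :
    ContinuousAt (fun z : ℝ × EuclideanSpace ℝ (Fin n) => heatKernel z.1 z.2) (t, x) := by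
  have h0 : (0 : ℝ) < 4 * Real.pi * t := by positivity
  have h1 : ContinuousAt (fun z : ℝ × EuclideanSpace ℝ (Fin n) =>
      Real.sqrt ((4 * Real.pi * z.1) ^ n)) (t, x) := by fun_prop
  have h2 : ContinuousAt (fun z : ℝ × EuclideanSpace ℝ (Fin n) => -‖z.2‖ ^ 2 / (4 * z.1)) (t, x) :=
    ContinuousAt.div (by fun_prop) (by fun_prop) (by positivity)
  exact (continuousAt_const.div h1 (Real.sqrt_pos.2 (by positivity)).ne').mul h2.rexp

theorem enorm_heat_le_of_kernel_le {t κ : ℝ} (hκ : ∀ z : EuclideanSpace ℝ (Fin n), heatKernel t z ≤ κ)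
    (f : EuclideanSpace ℝ (Fin n) → 𝕜) (x : EuclideanSpace ℝ (Fin n)) :
    ‖heat t f x‖ₑ ≤ ENNReal.ofReal κ * ∫⁻ y, ‖f y‖ₑ := by
  rw [← lintegral_const_mul' _ _ ENNReal.ofReal_ne_top]
  refine (enorm_heat_le t f x).trans (lintegral_mono fun y => ?_)
  gcongr
  exact hκ _

theorem integrable_heatKernel_smul {t : ℝ} (ht : 0 < t) {f : EuclideanSpace ℝ (Fin n) → 𝕜}
    (hf : Integrable f volume) (x : EuclideanSpace ℝ (Fin n)) :
    Integrable (fun y => heatKernel t (x - y) • f y) volume := by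
  refine Integrable.bdd_smul (C := t ^ (-(n : ℝ) / 2)) (φ := fun y => heatKernel t (x - y)) hf
    ((continuous_heatKernel t).comp (continuous_const.sub continuous_id)).aestronglyMeasurable
    (Eventually.of_forall fun y => ?_)
  rw [Real.norm_of_nonneg (heatKernel_nonneg _ _)]
  exact heatKernel_le ht _

theorem heat_sub {t : ℝ} {f g : EuclideanSpace ℝ (Fin n) → 𝕜} {x : EuclideanSpace ℝ (Fin n)}
    (hf : Integrable (fun y => heatKernel t (x - y) • f y) volume)
    (hg : Integrable (fun y => heatKernel t (x - y) • g y) volume) :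
    heat t (f - g) x = heat t f x - heat t g x := by
  unfold heat
  rw [← integral_sub hf hg]
  simp only [Pi.sub_apply, smul_sub]

/-- If `τ ↦ f τ` is continuous with values in `L^1`, then `e^{(t - τ)Δ} f(τ) (x)` is jointly
continuous in `τ < t` and `x`. -/
theorem continuousOn_heat {a t : ℝ} {f : ℝ → EuclideanSpace ℝ (Fin n) → 𝕜}
    (hint : ∀ τ ∈ Ioo a t, Integrable (f τ) volume)
    (hcont : ∀ τ₀ ∈ Ioo a t, Tendsto (fun τ => ∫⁻ y, ‖f τ y - f τ₀ y‖ₑ) (𝓝 τ₀) (𝓝 0)) :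
    ContinuousOn (fun z : ℝ × EuclideanSpace ℝ (Fin n) => heat (t - z.1) (f z.1) z.2)
      (Ioo a t ×ˢ univ) := by
  rw [(isOpen_Ioo.prod isOpen_univ).continuousOn_iff]
  rintro ⟨τ₀, x₀⟩ ⟨hτ₀, -⟩
  have hτ₀' : τ₀ ∈ Ioo a t := hτ₀
  set η := (t - τ₀) / 2 with hη
  have hη0 : 0 < η := by have := hτ₀'.2; rw [hη]; linarith
  set κ := η ^ (-(n : ℝ) / 2) with hκ
  have hκ0 : 0 ≤ κ := by positivity
  have hn0 : -(n : ℝ) / 2 ≤ 0 := by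
    have : (0 : ℝ) ≤ n := n.cast_nonneg
    linarith
  have hbound : ∀ σ, η ≤ σ → ∀ z : EuclideanSpace ℝ (Fin n), heatKernel σ z ≤ κ := fun σ hσ z =>
    (heatKernel_le (hη0.trans_le hσ) z).trans (Real.rpow_le_rpow_of_nonpos hη0 hσ hn0)
  have hfst : Tendsto (fun z : ℝ × EuclideanSpace ℝ (Fin n) => z.1) (𝓝 (τ₀, x₀)) (𝓝 τ₀) :=
    continuous_fst.tendsto _
  have hev : ∀ᶠ z : ℝ × EuclideanSpace ℝ (Fin n) in 𝓝 (τ₀, x₀), z.1 ∈ Ioo a t ∧ η ≤ t - z.1 := by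
    have h1 : ∀ᶠ τ in 𝓝 τ₀, τ ∈ Ioo a t ∧ η ≤ t - τ := by
      have h2 : Iio (τ₀ + η) ∈ 𝓝 τ₀ := Iio_mem_nhds (by linarith)
      filter_upwards [isOpen_Ioo.mem_nhds hτ₀', h2] with τ h3 (h4 : τ < τ₀ + η)
      exact ⟨h3, by linarith⟩
    exact hfst.eventually h1
  -- the part with frozen `f τ₀`
  have hA : Tendsto (fun z : ℝ × EuclideanSpace ℝ (Fin n) => heat (t - z.1) (f τ₀) z.2)
      (𝓝 (τ₀, x₀)) (𝓝 (heat (t - τ₀) (f τ₀) x₀)) := by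
    unfold heat
    refine tendsto_integral_filter_of_dominated_convergence (fun y => κ * ‖f τ₀ y‖) ?_ ?_
      ((hint τ₀ hτ₀').norm.const_mul κ) (Eventually.of_forall fun y => ?_)
    · filter_upwards [hev] with z hz
      exact (integrable_heatKernel_smul (hη0.trans_le hz.2) (hint τ₀ hτ₀') z.2).1
    · filter_upwards [hev] with z hz
      refine Eventually.of_forall fun y => ?_
      rw [norm_smul, Real.norm_of_nonneg (heatKernel_nonneg _ _)]
      gcongr
      exact hbound _ hz.2 _
    · have h1 : ContinuousAt (fun z : ℝ × EuclideanSpace ℝ (Fin n) => (t - z.1, z.2 - y))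
          (τ₀, x₀) := by fun_prop
      have h2 := continuousAt_heatKernel (n := n) (sub_pos.2 hτ₀'.2) (x₀ - y)
      exact (Tendsto.comp (f := fun z : ℝ × EuclideanSpace ℝ (Fin n) => (t - z.1, z.2 - y))
        (y := 𝓝 (t - τ₀, x₀ - y)) h2 h1).smul_const _
  -- the remainder
  have hB : Tendsto (fun z : ℝ × EuclideanSpace ℝ (Fin n) => heat (t - z.1) (f z.1 - f τ₀) z.2)
      (𝓝 (τ₀, x₀)) (𝓝 0) := by
    rw [tendsto_zero_iff_enorm_tendsto_zero]
    have h1 : Tendsto (fun z : ℝ × EuclideanSpace ℝ (Fin n) =>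
        ENNReal.ofReal κ * ∫⁻ y, ‖f z.1 y - f τ₀ y‖ₑ) (𝓝 (τ₀, x₀)) (𝓝 0) := by
      have := ENNReal.Tendsto.const_mul ((hcont τ₀ hτ₀').comp hfst)
        (Or.inr (ENNReal.ofReal_ne_top (r := κ)))
      rwa [mul_zero] at this
    refine tendsto_of_tendsto_of_tendsto_of_le_of_le' tendsto_const_nhds h1
      (Eventually.of_forall fun _ => zero_le) ?_
    filter_upwards [hev] with z hz
    exact enorm_heat_le_of_kernel_le (hbound _ hz.2) _ _
  have hAB := hA.add hB
  rw [add_zero] at hAB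
  refine Tendsto.congr' ?_ hAB
  filter_upwards [hev] with z hz
  have hσ : 0 < t - z.1 := hη0.trans_le hz.2
  rw [heat_sub (integrable_heatKernel_smul hσ (hint _ hz.1) _)
    (integrable_heatKernel_smul hσ (hint _ hτ₀') _)]
  abel

theorem enorm_heat_le_tsum (hn : 0 < n) {t : ℝ} {f : EuclideanSpace ℝ (Fin n) → 𝕜}
    {x : EuclideanSpace ℝ (Fin n)}
    (hf : Integrable (fun y => heatKernel t (x - y) • f y) volume) :
    ‖heat t f x‖ₑ ≤ ∑' k, ‖heat t ((annulus n k).indicator f) x‖ₑ := by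
  have h1 := hasSum_integral_iUnion (f := fun y => heatKernel t (x - y) • f y) (μ := volume)
    (measurableSet_annulus n) (pairwise_disjoint_annulus n) hf.integrableOn
  have h2 : heat t f x = ∫ y in ⋃ k, annulus n k, heatKernel t (x - y) • f y := by
    rw [Measure.restrict_eq_self_of_ae_mem (ae_mem_iUnion_annulus hn)]
    rfl
  have h3 : ∀ k, ∫ y in annulus n k, heatKernel t (x - y) • f y =
      heat t ((annulus n k).indicator f) x := fun k => by
    rw [← integral_indicator (measurableSet_annulus n k), heat]
    refine integral_congr_ae (Eventually.of_forall fun y => ?_)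
    by_cases hy : y ∈ annulus n k
    · simp [hy]
    · simp [hy]
  rw [h2, ← h1.tsum_eq, tsum_congr h3]
  exact enorm_tsum_le_tsum_enorm

/-- If two mild solutions agree before `t₀`, their difference at `t` only sees the times in
`(t₀, t)`. -/
theorem IsMildSolution.enorm_sub_le (hn : 0 < n) {γ α T : ℝ} {u₀ : EuclideanSpace ℝ (Fin n) → 𝕜}
    {u v : ℝ → EuclideanSpace ℝ (Fin n) → 𝕜} (hu : IsMildSolution γ α T u₀ u)
    (hv : IsMildSolution γ α T u₀ v) {t₀ t : ℝ} (ht : t ∈ Ioc 0 T)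
    (hagree : ∀ τ ∈ Ioo 0 t₀, u τ =ᵐ[volume] v τ) :
    ∀ᵐ x, ‖u t x - v t x‖ₑ ≤ ∫⁻ τ in Ioo t₀ t, ∑' k,
      ‖heat (t - τ) ((annulus n k).indicator (nonlin γ α (u τ) - nonlin γ α (v τ))) x‖ₑ := by
  filter_upwards [hu.duhamel t ht, hv.duhamel t ht, hu.intervalIntegrable t ht,
    hv.intervalIntegrable t ht, hu.integrable_heat_nonlin t ht, hv.integrable_heat_nonlin t ht]
    with x hux hvx hui hvi huk hvk
  rw [hux, hvx, add_sub_add_left_eq_sub, ← intervalIntegral.integral_sub hui hvi,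
    intervalIntegral.integral_of_le ht.1.le, integral_Ioc_eq_integral_Ioo]
  refine (enorm_integral_le_lintegral_enorm _).trans ?_
  rw [← lintegral_indicator measurableSet_Ioo, ← lintegral_indicator measurableSet_Ioo]
  refine lintegral_mono_ae ?_
  filter_upwards [huk, hvk, measure_eq_zero_iff_ae_notMem.1 (measure_singleton t₀)]
    with τ hτu hτv hτ₀
  by_cases hτ : τ ∈ Ioo 0 t
  · rw [indicator_of_mem hτ]
    rcases lt_or_gt_of_ne (by simpa using hτ₀ : τ ≠ t₀) with hlt | hgt
    · rw [heat_congr_ae (nonlin_congr_ae γ α (hagree τ ⟨hτ.1, hlt⟩)), sub_self, enorm_zero]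
      exact zero_le
    · rw [indicator_of_mem (show τ ∈ Ioo t₀ t from ⟨hgt, hτ.2⟩), ← heat_sub (hτu hτ) (hτv hτ)]
      refine enorm_heat_le_tsum hn ?_
      refine ((hτu hτ).sub (hτv hτ)).congr (Eventually.of_forall fun y => ?_)
      simp only [Pi.sub_apply, smul_sub]
  · rw [indicator_of_notMem hτ]
    exact zero_le

/-! ### The contraction estimate -/

section Curve

variable {s T : ℝ} {q r : ℝ≥0∞} {u v : ℝ → EuclideanSpace ℝ (Fin n) → 𝕜}

theorem MemCHerzClosure.aestronglyMeasurable (hu : MemCHerzClosure s q r T u) {t : ℝ}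
    (ht : t ∈ Icc 0 T) : AEStronglyMeasurable (u t) volume := (hu.1 t ht).1.1

theorem MemCHerzClosure.herzPiece_ne_top (hr : 0 < r) (hu : MemCHerzClosure s q r T u) {t : ℝ}
    (ht : t ∈ Icc 0 T) (k : ℤ) : herzPiece s q (u t) k ≠ ∞ :=
  ne_top_of_le_ne_top (hu.1 t ht).1.2.ne (herzPiece_le_herzNorm s q hr _ k)

theorem MemCHerzClosure.tendsto_herzPiece (hr : 0 < r) (hu : MemCHerzClosure s q r T u) {t₀ : ℝ}
    (ht₀ : t₀ ∈ Icc 0 T) (k : ℤ) :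
    Tendsto (fun t => herzPiece s q (u t - u t₀) k) (𝓝[Icc 0 T] t₀) (𝓝 0) :=
  tendsto_of_tendsto_of_tendsto_of_le_of_le tendsto_const_nhds (hu.2 t₀ ht₀) (fun _ => zero_le)
    fun _ => herzPiece_le_herzNorm s q hr _ k

theorem nonlin_zero (γ : ℝ) {α : ℝ} : nonlin γ α (0 : EuclideanSpace ℝ (Fin n) → 𝕜) = 0 := by
  funext x; simp [nonlin]

theorem MemCHerzClosure.integrable_indicator_nonlin (hr : 0 < r) (γ : ℝ) {α : ℝ} (hα : 1 < α)
    (hq : ENNReal.ofReal α ≤ q) (hu : MemCHerzClosure s q r T u) {t : ℝ} (ht : t ∈ Icc 0 T)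
    (k : ℤ) : Integrable ((annulus n k).indicator (nonlin γ α (u t))) volume := by
  have hum := hu.aestronglyMeasurable ht
  have hNm := aestronglyMeasurable_nonlin γ α hum
  refine ⟨hNm.indicator (measurableSet_annulus n k), ?_⟩
  obtain ⟨C, -, hC⟩ := herzPiece_nonlin_sub_le (n := n) (𝕜 := 𝕜) γ hα s hq
  obtain ⟨C', hC't, hC'⟩ := lintegral_indicator_annulus_le (n := n) (𝕜 := 𝕜) (α * s - γ)
    (one_le_div_ofReal (by linarith) hq) k
  have h1 := hC k (u t) 0 hum aestronglyMeasurable_zero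
  rw [nonlin_zero, sub_zero, sub_zero] at h1
  have hz : herzPiece s q (0 : EuclideanSpace ℝ (Fin n) → 𝕜) k = 0 := by
    simp [herzPiece]
  rw [hz, ENNReal.zero_rpow_of_pos (by linarith), add_zero] at h1
  have hfin := hu.herzPiece_ne_top hr ht k
  refine lt_of_le_of_lt ((hC' _ hNm).trans (mul_le_mul_right h1 _)) (Ne.lt_top ?_)
  exact ENNReal.mul_ne_top hC't (ENNReal.mul_ne_top ENNReal.ofReal_ne_top
    (ENNReal.mul_ne_top (ENNReal.rpow_ne_top_of_nonneg (by linarith) hfin) hfin))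

/-- On each annulus the nonlinear term is continuous in time with values in `L^1`. -/
theorem MemCHerzClosure.tendsto_lintegral_nonlin (hr : 0 < r) (γ : ℝ) {α : ℝ} (hα : 1 < α)
    (hq : ENNReal.ofReal α ≤ q) (hu : MemCHerzClosure s q r T u) {t₀ : ℝ} (ht₀ : t₀ ∈ Icc 0 T)
    (k : ℤ) : Tendsto (fun t => ∫⁻ x, ‖(annulus n k).indicator
      (nonlin γ α (u t) - nonlin γ α (u t₀)) x‖ₑ) (𝓝[Icc 0 T] t₀) (𝓝 0) := by
  have hα0 : 0 < α := by linarith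
  have hp : 0 ≤ α - 1 := by linarith
  have hq1 : 1 ≤ q := (ENNReal.one_lt_ofReal.2 hα).le.trans hq
  have hum₀ := hu.aestronglyMeasurable ht₀
  obtain ⟨C, -, hC⟩ := herzPiece_nonlin_sub_le (n := n) (𝕜 := 𝕜) γ hα s hq
  obtain ⟨C', hC't, hC'⟩ := lintegral_indicator_annulus_le (n := n) (𝕜 := 𝕜) (α * s - γ)
    (one_le_div_ofReal hα0 hq) k
  have hlim := hu.tendsto_herzPiece hr ht₀ k
  set a := herzPiece s q (u t₀) k with ha
  have hat : a ≠ ∞ := hu.herzPiece_ne_top hr ht₀ k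
  set D : ℝ≥0∞ := C' * (ENNReal.ofReal C * ((1 + a) ^ (α - 1) + a ^ (α - 1))) with hD
  have hDt : D ≠ ∞ := ENNReal.mul_ne_top hC't (ENNReal.mul_ne_top ENNReal.ofReal_ne_top
    (ENNReal.add_ne_top.2 ⟨ENNReal.rpow_ne_top_of_nonneg hp (by simpa using hat),
      ENNReal.rpow_ne_top_of_nonneg hp hat⟩))
  have hlim2 := ENNReal.Tendsto.const_mul hlim (Or.inr hDt)
  rw [mul_zero] at hlim2
  refine tendsto_of_tendsto_of_tendsto_of_le_of_le' tendsto_const_nhds hlim2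
    (Eventually.of_forall fun _ => zero_le) ?_
  filter_upwards [hlim.eventually_le_const one_pos, self_mem_nhdsWithin] with t ht htT
  have hum := hu.aestronglyMeasurable htT
  have h1 : herzPiece s q (u t) k ≤ 1 + a :=
    (herzPiece_le_sub_add s hq1 hum hum₀ k).trans (by gcongr)
  refine (hC' _ ((aestronglyMeasurable_nonlin γ α hum).sub
    (aestronglyMeasurable_nonlin γ α hum₀))).trans ?_
  rw [hD, mul_assoc, mul_assoc]
  gcongr
  refine (hC k (u t) (u t₀) hum hum₀).trans ?_
  gcongr

/-- Joint measurability of the pieces of the Duhamel integrand of a difference. -/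
theorem measurable_indicator_heat_nonlin_sub (hr : 0 < r) (γ : ℝ) {α : ℝ} (hα : 1 < α)
    (hq : ENNReal.ofReal α ≤ q) (hu : MemCHerzClosure s q r T u) (hv : MemCHerzClosure s q r T v)
    {a t : ℝ} (ha : 0 ≤ a) (ht : t ≤ T) (k : ℤ) :
    Measurable fun z : ℝ × EuclideanSpace ℝ (Fin n) => (Ioo a t).indicator (fun τ =>
      ‖heat (t - τ) ((annulus n k).indicator (nonlin γ α (u τ) - nonlin γ α (v τ))) z.2‖ₑ) z.1 := by
  classical
  have hsub : Ioo a t ⊆ Ioo 0 T := Ioo_subset_Ioo ha ht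
  have hnhds : ∀ τ ∈ Ioo a t, 𝓝[Icc 0 T] τ = 𝓝 τ := fun τ hτ =>
    nhdsWithin_eq_nhds.2 (Icc_mem_nhds (hsub hτ).1 (hsub hτ).2)
  have hc : ContinuousOn (fun z : ℝ × EuclideanSpace ℝ (Fin n) => heat (t - z.1)
      ((annulus n k).indicator (nonlin γ α (u z.1) - nonlin γ α (v z.1))) z.2)
      (Ioo a t ×ˢ univ) := by
    refine continuousOn_heat (f := fun τ => (annulus n k).indicator
      (nonlin γ α (u τ) - nonlin γ α (v τ))) (fun τ hτ => ?_) fun τ₀ hτ₀ => ?_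
    · rw [indicator_sub']
      exact (hu.integrable_indicator_nonlin hr γ hα hq (Ioo_subset_Icc_self (hsub hτ)) k).sub
        (hv.integrable_indicator_nonlin hr γ hα hq (Ioo_subset_Icc_self (hsub hτ)) k)
    · have hτ₀' := Ioo_subset_Icc_self (hsub hτ₀)
      have h1 := (hu.tendsto_lintegral_nonlin hr γ hα hq hτ₀' k).add
        (hv.tendsto_lintegral_nonlin hr γ hα hq hτ₀' k)
      rw [add_zero, hnhds τ₀ hτ₀] at h1
      refine tendsto_of_tendsto_of_tendsto_of_le_of_le' tendsto_const_nhds h1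
        (Eventually.of_forall fun _ => zero_le) ?_
      filter_upwards [isOpen_Ioo.mem_nhds hτ₀] with τ hτ
      have hm : ∀ {w : ℝ → EuclideanSpace ℝ (Fin n) → 𝕜}, MemCHerzClosure s q r T w →
          AEMeasurable (fun x => ‖(annulus n k).indicator
            (nonlin γ α (w τ) - nonlin γ α (w τ₀)) x‖ₑ) volume := fun hw =>
        (((aestronglyMeasurable_nonlin γ α
          (hw.aestronglyMeasurable (Ioo_subset_Icc_self (hsub hτ)))).sub
          (aestronglyMeasurable_nonlin γ α (hw.aestronglyMeasurable hτ₀'))).indicator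
          (measurableSet_annulus n k)).enorm
      rw [← lintegral_add_left' (hm hu)]
      refine lintegral_mono fun x => ?_
      have e : (annulus n k).indicator (nonlin γ α (u τ) - nonlin γ α (v τ)) x -
          (annulus n k).indicator (nonlin γ α (u τ₀) - nonlin γ α (v τ₀)) x =
          (annulus n k).indicator (nonlin γ α (u τ) - nonlin γ α (u τ₀)) x -
          (annulus n k).indicator (nonlin γ α (v τ) - nonlin γ α (v τ₀)) x := by
        by_cases hx : x ∈ annulus n k
        · simp only [indicator_of_mem hx, Pi.sub_apply]; abel
        · simp only [indicator_of_notMem hx, sub_self]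
      rw [e]
      exact enorm_sub_le
  have h2 := (hc.measurable_piecewise (g := fun _ => 0) continuousOn_const
    (measurableSet_Ioo.prod MeasurableSet.univ)).enorm
  convert! h2 using 1
  funext z
  by_cases hz : z.1 ∈ Ioo a t
  · simp [Set.piecewise, hz]
  · simp [Set.piecewise, hz]

/-- The contraction estimate: the difference of two solutions agreeing before `t₀` is bounded, on
each annulus at time `t`, by the time integral of a majorant `c` of the linearized operator
times a bound `W` for the difference on `(t₀, t)`. -/
theorem IsMildSolution.herzPiece_sub_le (hn : 0 < n) {γ α : ℝ} (hα : 1 < α)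
    (hq : ENNReal.ofReal α ≤ q) (hr : 0 < r) {β : ℝ} (hβ : β = s + n * (1 / q).toReal)
    (hs' : α * s - γ + n * (α * (1 / q).toReal) = β + 2) (hβ0 : 0 ≤ β) (hβn : β + 2 ≤ n) :
    ∃ C : ℝ≥0∞, C ≠ ∞ ∧ ∀ (T : ℝ) (u₀ : EuclideanSpace ℝ (Fin n) → 𝕜)
      (u v : ℝ → EuclideanSpace ℝ (Fin n) → 𝕜),
      MemCHerzClosure s q r T u → MemCHerzClosure s q r T v →
      IsMildSolution γ α T u₀ u → IsMildSolution γ α T u₀ v →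
      ∀ (t₀ t : ℝ), 0 ≤ t₀ → t ∈ Ioc 0 T → (∀ τ ∈ Ioo 0 t₀, u τ =ᵐ[volume] v τ) →
      ∀ (j : ℤ) (c : ℝ → ℝ≥0∞) (W : ℝ≥0∞), Measurable c →
      (∀ τ ∈ Ioo t₀ t, ∀ k, herzPiece s q (u τ - v τ) k ≤ W) →
      (∀ τ ∈ Ioo t₀ t, ∑' k, ENNReal.ofReal (annulusKernel n β
          ((n : ℝ) / 2 * (α - 1) * (1 / q).toReal) j k (t - τ)) *
        (herzPiece s q (u τ) k ^ (α - 1) + herzPiece s q (v τ) k ^ (α - 1)) ≤ c (t - τ)) →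
      herzPiece s q (u t - v t) j ≤ C * W * ∫⁻ τ in Ioo 0 (t - t₀), c τ := by
  have hq1 : 1 < q := (ENNReal.one_lt_ofReal.2 hα).trans_le hq
  obtain ⟨C₁, hC₁, h₁⟩ := herzPiece_heat_le (n := n) (𝕜 := 𝕜) hα hq hβ hs' hβ0 hβn
  obtain ⟨C₂, hC₂, h₂⟩ := herzPiece_nonlin_sub_le (n := n) (𝕜 := 𝕜) γ hα s hq
  set θ := (n : ℝ) / 2 * (α - 1) * (1 / q).toReal with hθ
  refine ⟨ENNReal.ofReal C₁ * ENNReal.ofReal C₂, ENNReal.mul_ne_top ENNReal.ofReal_ne_top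
    ENNReal.ofReal_ne_top, ?_⟩
  intro T u₀ u v hu hv hus hvs t₀ t ht₀ ht hagree j c W hc hW hcb
  set F : ℝ → EuclideanSpace ℝ (Fin n) → 𝕜 := fun τ => nonlin γ α (u τ) - nonlin γ α (v τ) with hF
  set G : ℤ → ℝ → EuclideanSpace ℝ (Fin n) → ℝ≥0∞ := fun k τ x => (Ioo t₀ t).indicator (fun τ =>
    ‖heat (t - τ) ((annulus n k).indicator (F τ)) x‖ₑ) τ with hG
  have hGm : ∀ k, Measurable (Function.uncurry (G k)) := fun k =>
    measurable_indicator_heat_nonlin_sub hr γ hα hq hu hv ht₀ ht.2 k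
  set D : ℝ≥0∞ := ENNReal.ofReal ((2 : ℝ) ^ ((j : ℝ) * s)) with hD
  have hD0 : D ≠ 0 := by
    rw [hD, Ne, ENNReal.ofReal_eq_zero, not_le]; positivity
  have hDt : D ≠ ∞ := ENNReal.ofReal_ne_top
  set μ := (volume : Measure (EuclideanSpace ℝ (Fin n))).restrict (annulus n j) with hμ
  set A : ℝ≥0∞ := ENNReal.ofReal C₁ * ENNReal.ofReal C₂ * W with hA
  have hpiece : ∀ f : EuclideanSpace ℝ (Fin n) → 𝕜, herzPiece s q f j = D * eLpNorm f q μ :=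
    fun f => by
      rw [herzPiece, eLpNorm_indicator_eq_eLpNorm_restrict (measurableSet_annulus n j)]
  -- the bound at a fixed time, by summation over the annuli
  have hfix : ∀ τ ∈ Ioo t₀ t, eLpNorm (fun x => ∑' k, G k τ x) q μ ≤ D⁻¹ * (A * c (t - τ)) := by
    intro τ hτ
    have hτT : τ ∈ Icc 0 T := ⟨ht₀.trans hτ.1.le, hτ.2.le.trans ht.2⟩
    have hum := hu.aestronglyMeasurable hτT
    have hvm := hv.aestronglyMeasurable hτT
    have hFm : AEStronglyMeasurable (F τ) volume :=
      (aestronglyMeasurable_nonlin γ α hum).sub (aestronglyMeasurable_nonlin γ α hvm)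
    have hGτ : ∀ k, Measurable (G k τ) := fun k => (hGm k).comp measurable_prodMk_left
    refine (eLpNorm_tsum_le hq1 hGτ).trans ?_
    have h3 : ∀ k, eLpNorm (G k τ) q μ =
        D⁻¹ * herzPiece s q (heat (t - τ) ((annulus n k).indicator (F τ))) j := fun k => by
      rw [hpiece, ← mul_assoc, ENNReal.inv_mul_cancel hD0 hDt, one_mul]
      simp only [hG, indicator_of_mem hτ]
      rw [eLpNorm_enorm]
    rw [tsum_congr h3, ENNReal.tsum_mul_left]
    gcongr
    calc ∑' k, herzPiece s q (heat (t - τ) ((annulus n k).indicator (F τ))) j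
        ≤ ∑' k, A * (ENNReal.ofReal (annulusKernel n β θ j k (t - τ)) *
          (herzPiece s q (u τ) k ^ (α - 1) + herzPiece s q (v τ) k ^ (α - 1))) := by
          refine ENNReal.tsum_le_tsum fun k => ?_
          refine (h₁ j k (t - τ) (sub_pos.2 hτ.2) (F τ) hFm).trans ?_
          refine (mul_le_mul_right ((h₂ k (u τ) (v τ) hum hvm).trans
            (mul_le_mul_right (mul_le_mul_right (hW τ hτ k) _) _)) _).trans (le_of_eq ?_)
          rw [ENNReal.ofReal_mul hC₁.le, hA]
          ring
      _ = A * ∑' k, ENNReal.ofReal (annulusKernel n β θ j k (t - τ)) *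
          (herzPiece s q (u τ) k ^ (α - 1) + herzPiece s q (v τ) k ^ (α - 1)) :=
          ENNReal.tsum_mul_left
      _ ≤ A * c (t - τ) := by
          gcongr
          exact hcb τ hτ
  have hmink := eLpNorm_lintegral_le (μ := μ) (ν := volume.restrict (Ioo t₀ t)) hq1
    (g := fun τ x => ∑' k, G k τ x) (Measurable.tsum hGm)
    (c := fun τ => D⁻¹ * (A * c (t - τ)))
    (((hc.comp (measurable_const.sub measurable_id)).const_mul _).const_mul _)
    ((ae_restrict_iff' measurableSet_Ioo).2 (Eventually.of_forall hfix))
  have hint : ∫⁻ τ in Ioo t₀ t, c (t - τ) = ∫⁻ τ in Ioo 0 (t - t₀), c τ := by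
    rw [← lintegral_indicator measurableSet_Ioo, ← lintegral_indicator measurableSet_Ioo,
      ← lintegral_sub_left_eq_self ((Ioo 0 (t - t₀)).indicator c) t]
    refine lintegral_congr fun τ => ?_
    have hiff : t - τ ∈ Ioo 0 (t - t₀) ↔ τ ∈ Ioo t₀ t := by
      simp only [mem_Ioo]
      constructor <;> rintro ⟨h1, h2⟩ <;> constructor <;> linarith
    by_cases h : τ ∈ Ioo t₀ t
    · rw [indicator_of_mem h, indicator_of_mem (hiff.2 h)]
    · rw [indicator_of_notMem h, indicator_of_notMem (mt hiff.1 h)]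
  have hDit : D⁻¹ ≠ ∞ := ENNReal.inv_ne_top.2 hD0
  have hcm : Measurable fun τ => c (t - τ) := hc.comp (measurable_const.sub measurable_id)
  rw [lintegral_const_mul' _ _ hDit, lintegral_const_mul _ hcm, hint] at hmink
  rw [hpiece]
  have hle : eLpNorm (u t - v t) q μ ≤
      eLpNorm (fun x => ∫⁻ τ, ∑' k, G k τ x ∂volume.restrict (Ioo t₀ t)) q μ := by
    refine eLpNorm_mono_enorm_ae (ae_restrict_of_ae ?_)
    filter_upwards [hus.enorm_sub_le hn hvs ht hagree] with x hx
    rw [enorm_eq_self]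
    refine hx.trans (le_of_eq (setLIntegral_congr_fun measurableSet_Ioo fun τ hτ => ?_))
    simp only [hG, indicator_of_mem hτ, hF]
  calc D * eLpNorm (u t - v t) q μ ≤ D * (D⁻¹ * (A * ∫⁻ τ in Ioo 0 (t - t₀), c τ)) := by
        gcongr
        exact hle.trans hmink
    _ = _ := by rw [← mul_assoc, ENNReal.mul_inv_cancel hD0 hDt, one_mul]

end Curve

/-! ### Small tails and uniqueness -/

/-- Near every time, uniformly, the `p`-th powers of the Herz pieces of `u` are bounded, and
`N`-small off a finite set of annuli. -/
def HasSmallTails (N : (ℤ → ℝ≥0∞) → ℝ≥0∞) (s : ℝ) (q : ℝ≥0∞) (p T : ℝ)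
    (u : ℝ → EuclideanSpace ℝ (Fin n) → 𝕜) : Prop :=
  ∀ t₀ ∈ Icc 0 T, ∀ η : ℝ≥0∞, 0 < η → ∃ (S : Finset ℤ) (B : ℝ≥0∞), B ≠ ∞ ∧
    ∀ᶠ t in 𝓝[Icc 0 T] t₀, N (fun k => if k ∈ S then 0 else herzPiece s q (u t) k ^ p) ≤ η ∧
      ∀ k, herzPiece s q (u t) k ^ p ≤ B

section Tails

variable {s T : ℝ} {q r : ℝ≥0∞} {u : ℝ → EuclideanSpace ℝ (Fin n) → 𝕜}

theorem ennreal_add_rpow_le (a b : ℝ≥0∞) {p : ℝ} (hp : 0 ≤ p) :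
    (a + b) ^ p ≤ 2 ^ p * (a ^ p + b ^ p) := by
  have h1 : a + b ≤ 2 * max a b := by
    rw [two_mul]
    exact add_le_add (le_max_left _ _) (le_max_right _ _)
  refine (ENNReal.rpow_le_rpow h1 hp).trans ?_
  rw [ENNReal.mul_rpow_of_nonneg _ _ hp]
  gcongr
  rcases le_total a b with h | h
  · rw [max_eq_right h]; exact le_add_self
  · rw [max_eq_left h]; exact le_self_add

theorem MemCHerzClosure.eventually_herzPiece_le (hq : 1 ≤ q) (hr : 0 < r)
    (hu : MemCHerzClosure s q r T u) {t₀ : ℝ} (ht₀ : t₀ ∈ Icc 0 T) {p : ℝ} (hp : 0 ≤ p) :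
    ∃ B : ℝ≥0∞, B ≠ ∞ ∧ ∀ᶠ t in 𝓝[Icc 0 T] t₀, ∀ k, herzPiece s q (u t) k ^ p ≤ B := by
  have hfin : 1 + herzNorm s q r (u t₀) ≠ ∞ :=
    ENNReal.add_ne_top.2 ⟨ENNReal.one_ne_top, (hu.1 t₀ ht₀).1.2.ne⟩
  refine ⟨(1 + herzNorm s q r (u t₀)) ^ p, ENNReal.rpow_ne_top_of_nonneg hp hfin, ?_⟩
  filter_upwards [(hu.2 t₀ ht₀).eventually_le_const one_pos, self_mem_nhdsWithin] with t ht htT k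
  refine ENNReal.rpow_le_rpow ?_ hp
  refine (herzPiece_le_sub_add s hq (hu.aestronglyMeasurable htT)
    (hu.aestronglyMeasurable ht₀) k).trans ?_
  gcongr
  · exact (herzPiece_le_herzNorm s q hr _ k).trans ht
  · exact herzPiece_le_herzNorm s q hr _ k

/-- The Herz pieces of a bounded function supported in a ball tend to zero. -/
theorem exists_finset_herzPiece_le (hβ : 0 < s + n * (1 / q).toReal)
    {g : EuclideanSpace ℝ (Fin n) → 𝕜} (hg : Continuous g) (hgc : HasCompactSupport g)
    {ε : ℝ≥0∞} (hε : 0 < ε) : ∃ S : Finset ℤ, ∀ k ∉ S, herzPiece s q g k ≤ ε := by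
  obtain ⟨M, hM⟩ := hg.bounded_above_of_compact_support hgc
  have hM0 : 0 ≤ M := (norm_nonneg _).trans (hM 0)
  obtain ⟨R, hR⟩ := hgc.isCompact.isBounded.subset_ball 0
  obtain ⟨c, hc, hvol⟩ := volume_annulus_le n
  set Qi := (1 / q).toReal with hQi
  have hQi0 : 0 ≤ Qi := ENNReal.toReal_nonneg
  have hle : ∀ k : ℤ, herzPiece s q g k ≤
      ENNReal.ofReal (M * c ^ Qi * (2 : ℝ) ^ ((k : ℝ) * (s + n * Qi))) := fun k => by
    have h1 : eLpNorm ((annulus n k).indicator g) q volume ≤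
        ENNReal.ofReal M * volume (annulus n k) ^ Qi := by
      have h2 : ∀ x, ‖(annulus n k).indicator g x‖ₑ ≤
          ‖(annulus n k).indicator (fun _ => ENNReal.ofReal M) x‖ₑ := fun x => by
        by_cases hx : x ∈ annulus n k
        · rw [indicator_of_mem hx, indicator_of_mem hx, enorm_eq_self, ← ofReal_norm]
          exact ENNReal.ofReal_le_ofReal (hM x)
        · simp [indicator_of_notMem hx]
      refine (eLpNorm_mono_enorm h2).trans ((eLpNorm_indicator_const_le _ q).trans_eq ?_)
      rw [enorm_eq_self, ← toReal_one_div]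
    unfold herzPiece
    calc _ ≤ ENNReal.ofReal ((2 : ℝ) ^ ((k : ℝ) * s)) * (ENNReal.ofReal M *
          ENNReal.ofReal (c * (2 : ℝ) ^ ((k : ℝ) * n)) ^ Qi) := by
          refine mul_le_mul_right (h1.trans ?_) _
          gcongr
          exact hvol k
      _ = _ := by
          rw [ENNReal.ofReal_rpow_of_nonneg (by positivity) hQi0, ← ENNReal.ofReal_mul hM0,
            ← ENNReal.ofReal_mul (by positivity), Real.mul_rpow hc.le (by positivity),
            ← Real.rpow_mul (by norm_num), mul_add, Real.rpow_add (by norm_num), ← mul_assoc]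
          congr 1
          rw [mul_assoc (k : ℝ)]
          ring
  have hlim : Tendsto (fun k : ℤ =>
      ENNReal.ofReal (M * c ^ Qi * (2 : ℝ) ^ ((k : ℝ) * (s + n * Qi)))) atBot (𝓝 0) := by
    have h1 : Tendsto (fun k : ℤ => (2 : ℝ) ^ ((k : ℝ) * (s + n * Qi))) atBot (𝓝 0) :=
      (tendsto_rpow_atBot_of_base_gt_one 2 (by norm_num)).comp
        ((tendsto_intCast_atBot_iff.2 tendsto_id).atBot_mul_const hβ)
    have h2 := ENNReal.tendsto_ofReal (h1.const_mul (M * c ^ Qi))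
    rwa [mul_zero, ENNReal.ofReal_zero] at h2
  obtain ⟨a, ha⟩ := eventually_atBot.1 (hlim.eventually_le_const hε)
  obtain ⟨m, hm⟩ := pow_unbounded_of_one_lt R (one_lt_two (α := ℝ))
  refine ⟨Finset.Icc a (m + 1), fun k hk => ?_⟩
  rw [Finset.mem_Icc, not_and_or, not_le, not_le] at hk
  rcases hk with hk | hk
  · exact (hle k).trans (ha k hk.le)
  · -- such an annulus lies outside the support
    have h0 : (annulus n k).indicator g = 0 := by
      funext x
      by_cases hx : x ∈ annulus n k
      · rw [indicator_of_mem hx]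
        refine image_eq_zero_of_notMem_tsupport fun hxs => ?_
        have h1 : ‖x‖ < R := by simpa using hR hxs
        have h2 : (2 : ℝ) ^ (m : ℤ) ≤ 2 ^ (k - 1) := zpow_le_zpow_right₀ (by norm_num) (by omega)
        have h3 := hx.1
        rw [zpow_natCast] at h2
        linarith
      · rw [indicator_of_notMem hx]; rfl
    rw [herzPiece, h0, eLpNorm_zero, mul_zero]
    exact zero_le

/-- For the supremum over the annuli, smallness of the tails comes from the approximation by
compactly supported smooth functions. -/
theorem MemCHerzClosure.hasSmallTails_iSup (hq : 1 ≤ q) (hr : 0 < r)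
    (hβ : 0 < s + n * (1 / q).toReal)
    (hu : MemCHerzClosure s q r T u) {p : ℝ} (hp : 0 < p) :
    HasSmallTails (fun b => ⨆ k, b k) s q p T u := by
  intro t₀ ht₀ η hη
  set ε : ℝ≥0∞ := η ^ (1 / p) / 3 with hε
  have hε0 : 0 < ε := ENNReal.div_pos (ENNReal.rpow_pos_of_nonneg hη (by positivity)).ne'
    (by norm_num)
  have hε3 : (ε + ε + ε) ^ p = η := by
    rw [hε, ENNReal.add_thirds, ← ENNReal.rpow_mul, one_div_mul_cancel hp.ne', ENNReal.rpow_one]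
  obtain ⟨g, hg, hgc, hgε⟩ := (hu.1 t₀ ht₀).2 ε hε0
  obtain ⟨S, hS⟩ := exists_finset_herzPiece_le hβ hg.continuous hgc hε0
  obtain ⟨B, hB, hBev⟩ := hu.eventually_herzPiece_le hq hr ht₀ hp.le
  refine ⟨S, B, hB, ?_⟩
  filter_upwards [hBev, (hu.2 t₀ ht₀).eventually_le_const hε0, self_mem_nhdsWithin]
    with t ht ht2 htT
  refine ⟨iSup_le fun k => ?_, ht⟩
  split_ifs with hk
  · exact zero_le
  · rw [← hε3]
    have hum := hu.aestronglyMeasurable htT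
    have hum₀ := hu.aestronglyMeasurable ht₀
    have hgm : AEStronglyMeasurable g volume := hg.continuous.aestronglyMeasurable
    gcongr
    refine (herzPiece_le_sub_add s hq hum hgm k).trans ?_
    gcongr
    · refine (herzPiece_sub_le_sub_add_sub s hq hum hum₀ hgm k).trans ?_
      gcongr
      · exact (herzPiece_le_herzNorm s q hr _ k).trans ht2
      · exact (herzPiece_le_herzNorm s q hr _ k).trans hgε.le
    · exact hS k hk

/-- The embedding of the sequence space `ℓ^r` into `ℓ^p`, for `r ≤ p`. -/
theorem tsum_herzPiece_rpow_le (hr : 0 < r) {p : ℝ} (hp : 0 < p) (hrp : r ≤ ENNReal.ofReal p)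
    (f : EuclideanSpace ℝ (Fin n) → 𝕜) :
    ∑' k, herzPiece s q f k ^ p ≤ herzNorm s q r f ^ p := by
  have hrt : r ≠ ∞ := ne_top_of_le_ne_top ENNReal.ofReal_ne_top hrp
  set ρ := r.toReal with hρ
  have hρ0 : 0 < ρ := ENNReal.toReal_pos hr.ne' hrt
  have hρp : ρ ≤ p := ENNReal.toReal_le_of_le_ofReal hp.le hrp
  set R := herzNorm s q r f with hR
  have hRe : R ^ ρ = ∑' k, herzPiece s q f k ^ ρ := by
    rw [hR, herzNorm, if_neg hrt, ← ENNReal.rpow_mul, one_div_mul_cancel hρ0.ne', ENNReal.rpow_one]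
  have hsplit : ∀ a : ℝ≥0∞, a ^ p = a ^ (p - ρ) * a ^ ρ := fun a => by
    rw [← ENNReal.rpow_add_of_nonneg _ _ (by linarith) hρ0.le, sub_add_cancel]
  calc ∑' k, herzPiece s q f k ^ p ≤ ∑' k, R ^ (p - ρ) * herzPiece s q f k ^ ρ := by
        refine ENNReal.tsum_le_tsum fun k => ?_
        rw [hsplit]
        have : 0 ≤ p - ρ := by linarith
        gcongr
        exact herzPiece_le_herzNorm s q hr f k
    _ = R ^ p := by rw [ENNReal.tsum_mul_left, ← hRe, hsplit R]

/-- If `r ≤ p`, the sums of the `p`-th powers of the pieces converge, and have small tails. -/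
theorem MemCHerzClosure.hasSmallTails_tsum (hq : 1 ≤ q) (hr : 0 < r)
    (hu : MemCHerzClosure s q r T u) {p : ℝ} (hp : 0 < p) (hrp : r ≤ ENNReal.ofReal p) :
    HasSmallTails (fun b => ∑' k, b k) s q p T u := by
  intro t₀ ht₀ η hη
  obtain ⟨ε, hε0, hε⟩ := exists_pos_mul_le (C := 2 ^ p * 2)
    (ENNReal.mul_ne_top (ENNReal.rpow_ne_top_of_nonneg hp.le ENNReal.ofNat_ne_top)
      ENNReal.ofNat_ne_top) hη
  have hε' : 0 < ε ^ (1 / p) := ENNReal.rpow_pos_of_nonneg hε0 (by positivity)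
  have hfin : ∑' k, herzPiece s q (u t₀) k ^ p ≠ ∞ :=
    ne_top_of_le_ne_top (ENNReal.rpow_ne_top_of_nonneg hp.le (hu.1 t₀ ht₀).1.2.ne)
      (tsum_herzPiece_rpow_le hr hp hrp _)
  obtain ⟨S, hS⟩ := ((ENNReal.tendsto_tsum_compl_atTop_zero hfin).eventually_le_const hε0).exists
  obtain ⟨B, hB, hBev⟩ := hu.eventually_herzPiece_le hq hr ht₀ hp.le
  refine ⟨S, B, hB, ?_⟩
  filter_upwards [hBev, (hu.2 t₀ ht₀).eventually_le_const hε', self_mem_nhdsWithin]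
    with t ht ht2 htT
  refine ⟨?_, ht⟩
  have hS' : ∑' k, (if k ∈ S then 0 else herzPiece s q (u t₀) k ^ p) ≤ ε := by
    refine le_trans (le_of_eq ?_) hS
    have h1 := tsum_subtype ((S : Set ℤ)ᶜ) fun k => herzPiece s q (u t₀) k ^ p
    refine Eq.trans (tsum_congr fun k => ?_) h1.symm
    by_cases hk : k ∈ S <;> simp [hk]
  have hdiff : ∑' k, herzPiece s q (u t - u t₀) k ^ p ≤ ε := by
    refine (tsum_herzPiece_rpow_le hr hp hrp _).trans ((ENNReal.rpow_le_rpow ht2 hp.le).trans_eq ?_)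
    rw [← ENNReal.rpow_mul, one_div_mul_cancel hp.ne', ENNReal.rpow_one]
  calc ∑' k, (if k ∈ S then 0 else herzPiece s q (u t) k ^ p)
      ≤ ∑' k, 2 ^ p * (herzPiece s q (u t - u t₀) k ^ p +
        if k ∈ S then 0 else herzPiece s q (u t₀) k ^ p) := by
        refine ENNReal.tsum_le_tsum fun k => ?_
        split_ifs with hk
        · exact zero_le
        · refine (ENNReal.rpow_le_rpow (herzPiece_le_sub_add s hq (hu.aestronglyMeasurable htT)
            (hu.aestronglyMeasurable ht₀) k) hp.le).trans (ennreal_add_rpow_le _ _ hp.le)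
    _ ≤ 2 ^ p * (ε + ε) := by
        rw [ENNReal.tsum_mul_left, ENNReal.tsum_add]
        gcongr
    _ = 2 ^ p * 2 * ε := by ring
    _ ≤ η := hε

end Tails

section Uniqueness

variable {s T : ℝ} {q r : ℝ≥0∞} {u v : ℝ → EuclideanSpace ℝ (Fin n) → 𝕜}

/-- Two solutions which agree up to a time agree a little longer. -/
theorem IsMildSolution.exists_agree_after (hn : 3 ≤ n) {γ α : ℝ} (hα : 1 < α)
    (hq : ENNReal.ofReal α ≤ q) (hr : 0 < r) {β : ℝ} (hβ : β = s + n * (1 / q).toReal)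
    (hs' : α * s - γ + n * (α * (1 / q).toReal) = β + 2) (hβ0 : 0 ≤ β) (hβn : β + 2 ≤ n)
    (hθ : (n : ℝ) / 2 * (α - 1) * (1 / q).toReal < 1)
    {N : (ℤ → ℝ≥0∞) → ℝ≥0∞} (hNmono : ∀ a b, (∀ k, a k ≤ b k) → N a ≤ N b)
    (hNadd : ∀ a b, N (fun k => a k + b k) ≤ N a + N b)
    (hN : KernelMajorant n β ((n : ℝ) / 2 * (α - 1) * (1 / q).toReal) N)
    {u₀ : EuclideanSpace ℝ (Fin n) → 𝕜}
    (hu : MemCHerzClosure s q r T u) (hv : MemCHerzClosure s q r T v)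
    (hus : IsMildSolution γ α T u₀ u) (hvs : IsMildSolution γ α T u₀ v)
    (hut : HasSmallTails N s q (α - 1) T u) (hvt : HasSmallTails N s q (α - 1) T v)
    {t₀ : ℝ} (ht₀ : t₀ ∈ Ico 0 T) (hagree : ∀ τ ∈ Icc 0 t₀, u τ =ᵐ[volume] v τ) :
    ∃ t₁ ∈ Ioc t₀ T, ∀ τ ∈ Icc 0 t₁, u τ =ᵐ[volume] v τ := by
  have hq1 : 1 < q := (ENNReal.one_lt_ofReal.2 hα).trans_le hq
  have ht₀T : t₀ ∈ Icc 0 T := Ico_subset_Icc_self ht₀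
  obtain ⟨C, hC, hcontr⟩ := IsMildSolution.herzPiece_sub_le (n := n) (𝕜 := 𝕜) (γ := γ)
    (by omega) hα hq hr hβ hs' hβ0 hβn
  obtain ⟨ε, hε0, hε⟩ := exists_pos_mul_le hC (ε := 2⁻¹) (by simp)
  obtain ⟨η, hη0, hsmall⟩ := hN.exists_small hn hθ hβ0 hβn hε0
  have hη2 : 0 < η / 2 := ENNReal.half_pos hη0.ne'
  obtain ⟨S₁, B₁, hB₁, hev₁⟩ := hut t₀ ht₀T (η / 2) hη2
  obtain ⟨S₂, B₂, hB₂, hev₂⟩ := hvt t₀ ht₀T (η / 2) hη2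
  obtain ⟨δ, hδ0, hδ⟩ := hsmall (S₁ ∪ S₂) (B₁ + B₂) (ENNReal.add_ne_top.2 ⟨hB₁, hB₂⟩)
  have hev := (hev₁.and hev₂).and (((hu.2 t₀ ht₀T).eventually_le_const one_pos).and
    ((hv.2 t₀ ht₀T).eventually_le_const one_pos))
  obtain ⟨ρ, hρ0, hρ⟩ := Metric.mem_nhdsWithin_iff.1 hev
  set t₁ := min (t₀ + min δ ρ / 2) T with ht₁
  have hm0 : 0 < min δ ρ := lt_min hδ0 hρ0
  have ht₀₁ : t₀ < t₁ := lt_min (by linarith) ht₀.2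
  have ht₁δ : t₁ - t₀ ≤ δ := by
    have h1 := min_le_left (t₀ + min δ ρ / 2) T
    have h2 := min_le_left δ ρ
    linarith
  have hnear : ∀ τ ∈ Ioc t₀ t₁, τ ∈ Icc 0 T ∧ τ ∈ Metric.ball t₀ ρ := fun τ hτ => by
    have h1 := min_le_left (t₀ + min δ ρ / 2) T
    have h2 := min_le_right δ ρ
    refine ⟨⟨ht₀.1.trans hτ.1.le, hτ.2.trans (min_le_right _ _)⟩, ?_⟩
    rw [Metric.mem_ball, Real.dist_eq, abs_of_pos (sub_pos.2 hτ.1)]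
    have := hτ.2
    linarith
  set W : ℝ≥0∞ := ⨆ τ ∈ Ioc t₀ t₁, ⨆ k, herzPiece s q (u τ - v τ) k with hW
  have hleW : ∀ τ ∈ Ioc t₀ t₁, ∀ k, herzPiece s q (u τ - v τ) k ≤ W := fun τ hτ k =>
    (le_iSup (fun k => herzPiece s q (u τ - v τ) k) k).trans
      (le_iSup₂ (f := fun τ (_ : τ ∈ Ioc t₀ t₁) => ⨆ k, herzPiece s q (u τ - v τ) k) τ hτ)
  have hWt : W ≠ ∞ := by
    refine ne_top_of_le_ne_top (ENNReal.ofNat_ne_top (n := 2)) (iSup₂_le fun τ hτ => iSup_le fun k => ?_)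
    obtain ⟨hτT, hτb⟩ := hnear τ hτ
    obtain ⟨-, h1, h2⟩ := hρ ⟨hτb, hτT⟩
    have hum := hu.aestronglyMeasurable hτT
    have hvm := hv.aestronglyMeasurable hτT
    have hum₀ := hu.aestronglyMeasurable ht₀T
    have e : herzPiece s q (u t₀ - v τ) k = herzPiece s q (v t₀ - v τ) k :=
      herzPiece_congr_ae s q ((hagree t₀ ⟨ht₀.1, le_rfl⟩).sub (ae_eq_refl _)) k
    refine (herzPiece_sub_le_sub_add_sub s hq1.le hum hum₀ hvm k).trans ?_
    rw [e, herzPiece_sub_comm s q (v t₀), ← one_add_one_eq_two]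
    gcongr
    · exact (herzPiece_le_herzNorm s q hr _ k).trans h1
    · exact (herzPiece_le_herzNorm s q hr _ k).trans h2
  have hhalf : W ≤ 2⁻¹ * W := by
    refine iSup₂_le fun t ht => iSup_le fun j => ?_
    obtain ⟨c, hcm, hcint, hc⟩ := hδ j
    have htT := (hnear t ht).1
    have h := hcontr T u₀ u v hu hv hus hvs t₀ t ht₀.1 ⟨ht₀.1.trans_lt ht.1, htT.2⟩
      (fun τ hτ => hagree τ ⟨hτ.1.le, hτ.2.le⟩) j c W hcm
      (fun τ hτ k => hleW τ ⟨hτ.1, hτ.2.le.trans ht.2⟩ k) fun τ hτ => ?_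
    · refine h.trans ?_
      calc C * W * ∫⁻ τ in Ioo 0 (t - t₀), c τ ≤ C * W * ε := by
            gcongr
            refine (lintegral_mono_set (Ioo_subset_Ioo_right ?_)).trans hcint
            have := ht.2
            linarith
        _ = C * ε * W := by ring
        _ ≤ _ := by gcongr
    · obtain ⟨hτT, hτb⟩ := hnear τ ⟨hτ.1, hτ.2.le.trans ht.2⟩
      obtain ⟨⟨⟨h1, h1'⟩, ⟨h2, h2'⟩⟩, -⟩ := hρ ⟨hτb, hτT⟩
      refine hc _ _ ?_ fun k _ => add_le_add (h1' k) (h2' k)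
      calc N (fun k => if k ∈ S₁ ∪ S₂ then 0 else
            herzPiece s q (u τ) k ^ (α - 1) + herzPiece s q (v τ) k ^ (α - 1))
          ≤ N (fun k => (if k ∈ S₁ then 0 else herzPiece s q (u τ) k ^ (α - 1)) +
            if k ∈ S₂ then 0 else herzPiece s q (v τ) k ^ (α - 1)) := by
            refine hNmono _ _ fun k => ?_
            by_cases hk1 : k ∈ S₁ <;> by_cases hk2 : k ∈ S₂ <;> simp [hk1, hk2]
        _ ≤ η / 2 + η / 2 := (hNadd _ _).trans (add_le_add h1 h2)
        _ = η := ENNReal.add_halves η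
  have hW0 : W = 0 := by
    by_contra h0
    have h1 : 2⁻¹ * W < W := by
      rw [mul_comm, ← div_eq_mul_inv]
      exact ENNReal.half_lt_self h0 hWt
    exact absurd hhalf (not_le.2 h1)
  refine ⟨t₁, ⟨ht₀₁, min_le_right _ _⟩, fun τ hτ => ?_⟩
  rcases le_or_gt τ t₀ with h | h
  · exact hagree τ ⟨hτ.1, h⟩
  · have hτT := (hnear τ ⟨h, hτ.2⟩).1
    have h0 := ae_eq_zero_of_herzPiece_eq_zero (s := s) (by omega) (zero_lt_one.trans hq1).ne'
      ((hu.aestronglyMeasurable hτT).sub (hv.aestronglyMeasurable hτT)) fun k =>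
      le_antisymm ((hleW τ ⟨h, hτ.2⟩ k).trans hW0.le) zero_le
    filter_upwards [h0] with x hx
    exact sub_eq_zero.1 hx

/-- The continuation argument: the supremum of the times of agreement is `T`. -/
theorem IsMildSolution.ae_eq_of_forall_exists_agree_after (hn : 0 < n) {γ α : ℝ} (hT : 0 < T)
    {u₀ : EuclideanSpace ℝ (Fin n) → 𝕜}
    (hus : IsMildSolution γ α T u₀ u) (hvs : IsMildSolution γ α T u₀ v)
    (hstep : ∀ t₀ ∈ Ico 0 T, (∀ τ ∈ Icc 0 t₀, u τ =ᵐ[volume] v τ) →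
      ∃ t₁ ∈ Ioc t₀ T, ∀ τ ∈ Icc 0 t₁, u τ =ᵐ[volume] v τ) :
    ∀ t ∈ Icc 0 T, u t =ᵐ[volume] v t := by
  set A : Set ℝ := {t | t ∈ Icc 0 T ∧ ∀ τ ∈ Icc 0 t, u τ =ᵐ[volume] v τ} with hA
  have h00 : u 0 =ᵐ[volume] v 0 := hus.initial.trans hvs.initial.symm
  have h0A : (0 : ℝ) ∈ A := ⟨⟨le_rfl, hT.le⟩, fun τ hτ => by
    rw [le_antisymm hτ.2 hτ.1]; exact h00⟩
  have hbdd : BddAbove A := ⟨T, fun t ht => ht.1.2⟩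
  set m := sSup A with hm
  have hm0 : 0 ≤ m := le_csSup hbdd h0A
  have hmT : m ≤ T := csSup_le ⟨0, h0A⟩ fun t ht => ht.1.2
  have hlt : ∀ τ, 0 ≤ τ → τ < m → u τ =ᵐ[volume] v τ := fun τ hτ0 hτm => by
    obtain ⟨t, htA, hτt⟩ := exists_lt_of_lt_csSup ⟨0, h0A⟩ hτm
    exact htA.2 τ ⟨hτ0, hτt.le⟩
  -- the Duhamel integral of the difference at time `m` vanishes
  have hmm : u m =ᵐ[volume] v m := by
    rcases hm0.eq_or_lt with h | h
    · rw [← h]; exact h00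
    · filter_upwards [hus.enorm_sub_le hn hvs ⟨h, hmT⟩ fun τ hτ => hlt τ hτ.1.le hτ.2] with x hx
      rw [Ioo_self, Measure.restrict_empty, lintegral_zero_measure, nonpos_iff_eq_zero,
        enorm_eq_zero] at hx
      exact sub_eq_zero.1 hx
  have hmA : ∀ τ ∈ Icc 0 m, u τ =ᵐ[volume] v τ := fun τ hτ => by
    rcases hτ.2.eq_or_lt with h | h
    · rw [h]; exact hmm
    · exact hlt τ hτ.1 h
  have hmeq : m = T := by
    by_contra hne
    obtain ⟨t₁, ht₁, h⟩ := hstep m ⟨hm0, lt_of_le_of_ne hmT hne⟩ hmA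
    have : t₁ ≤ m := le_csSup hbdd ⟨⟨hm0.trans ht₁.1.le, ht₁.2⟩, h⟩
    exact absurd ht₁.1 (not_lt.2 this)
  rw [← hmeq]
  exact hmA

end Uniqueness

end HardyHenon

theorem theorem1p2 {𝕜 : Type*} [RCLike 𝕜] (n : ℕ) (γ α s : ℝ) (q r : ℝ≥0∞)
    (hn : 3 ≤ n)
    (hγ : -min 2 (n : ℝ) < γ)
    (hα : 1 < α) (hα' : max 1 (1 + γ / n) ≤ α)
    (hs : γ / (α - 1) < s) (hsn : s ≤ n)
    (hq : ENNReal.ofReal α ≤ q) (hr : 0 < r)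
    (hpos : 0 < s / n + (1 / q).toReal)
    (hcase :
      (s / n + (1 / q).toReal = 1 / HardyHenon.qCrit n γ α ∧
        1 / HardyHenon.qCrit n γ α < 1 / HardyHenon.QCrit n γ α ∧
        q < ⊤ ∧ r = ⊤) ∨
      (s / n + (1 / q).toReal = 1 / HardyHenon.qCrit n γ α ∧
        1 / HardyHenon.qCrit n γ α = 1 / HardyHenon.QCrit n γ α ∧
        ((q < ⊤ ∧ r ≤ ENNReal.ofReal (α - 1)) ∨ r ≤ min 1 (ENNReal.ofReal (α - 1)))))
    (u₀ : EuclideanSpace ℝ (Fin n) → 𝕜) (hu₀ : HardyHenon.MemHerzClosure s q r u₀)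
    (T : ℝ) (hT : 0 < T)
    (u v : ℝ → EuclideanSpace ℝ (Fin n) → 𝕜)
    (hu : HardyHenon.MemCHerzClosure s q r T u)
    (hv : HardyHenon.MemCHerzClosure s q r T v)
    (hu_sol : HardyHenon.IsMildSolution γ α T u₀ u)
    (hv_sol : HardyHenon.IsMildSolution γ α T u₀ v) :
    ∀ t ∈ Icc 0 T, u t =ᵐ[volume] v t := by
  have hn' : (3 : ℝ) ≤ n := by exact_mod_cast hn
  have hn0 : (0 : ℝ) < n := by linarith
  have hp : 0 < α - 1 := by linarith
  have hq1 : 1 ≤ q := (ENNReal.one_lt_ofReal.2 hα).le.trans hq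
  set Qi := (1 / q).toReal with hQi
  set β := s + n * Qi with hβ
  have hβn : n * (s / n + Qi) = β := by rw [hβ]; field_simp
  have hβ0 : 0 < β := by rw [← hβn]; positivity
  -- the two critical exponents in terms of `β`
  have hqc : s / n + Qi = 1 / HardyHenon.qCrit n γ α → β * (α - 1) = 2 + γ := fun h => by
    rw [← hβn, h, HardyHenon.qCrit, one_div_div]
    field_simp
  have hQc : n * (1 / HardyHenon.QCrit n γ α) * α = n + γ := by
    rw [HardyHenon.QCrit, one_div_div]
    field_simp
  have hs2 : γ < s * (α - 1) := by rwa [div_lt_iff₀ hp] at hs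
  have hcrit : β * (α - 1) = 2 + γ := by
    rcases hcase with h | h
    exacts [hqc h.1, hqc h.1]
  -- the nonlinear term lives two orders below the solution, as the Laplacian requires
  have hs' : α * s - γ + n * (α * Qi) = β + 2 := by
    rw [hβ] at hcrit ⊢
    linarith
  -- subcriticality on a single annulus
  have hθ : (n : ℝ) / 2 * (α - 1) * Qi < 1 := by
    rw [hβ] at hcrit
    linarith
  rcases hcase with ⟨h1, h2, -, -⟩ | ⟨h1, h2, h3⟩
  · rw [← h1] at h2
    have h4 : β * α < n + γ := by
      rw [← hβn, ← hQc]
      gcongr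
    have h5 : β + 2 < n := by linarith
    exact hu_sol.ae_eq_of_forall_exists_agree_after (by omega) hT hv_sol fun t₀ ht₀ hagree =>
      hu_sol.exists_agree_after hn hα hq hr hβ hs' hβ0.le h5.le hθ
        (fun a b hab => iSup_mono hab)
        (fun a b => iSup_le fun k => add_le_add (le_iSup a k) (le_iSup b k))
        (HardyHenon.kernelMajorant_iSup hn hθ hβ0 h5) hu hv hv_sol
        (hu.hasSmallTails_iSup hq1 hr hβ0 hp) (hv.hasSmallTails_iSup hq1 hr hβ0 hp) ht₀ hagree
  · rw [← h1] at h2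
    have h4 : β * α = n + γ := by rw [← hβn, ← hQc, h2]
    have h5 : β + 2 = n := by linarith
    have hrp : r ≤ ENNReal.ofReal (α - 1) := by
      rcases h3 with h3 | h3
      exacts [h3.2, h3.trans (min_le_right _ _)]
    exact hu_sol.ae_eq_of_forall_exists_agree_after (by omega) hT hv_sol fun t₀ ht₀ hagree =>
      hu_sol.exists_agree_after hn hα hq hr hβ hs' hβ0.le h5.le hθ
        (fun a b hab => ENNReal.tsum_le_tsum hab)
        (fun a b => ENNReal.tsum_add.le)
        (HardyHenon.kernelMajorant_tsum hn hθ hβ0 h5) hu hv hv_sol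
        (hu.hasSmallTails_tsum hq1 hr hp hrp) (hv.hasSmallTails_tsum hq1 hr hp hrp) ht₀ hagree
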